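/- Let $p$ be a prime, let $G$ be a finite group and let $e$ be a central primitive idempotent of the group algebra $\mathbb{Q}_p[G]$. By Wedderburn's theorem $\mathbb{Q}_p[G]e \cong M_{m}(D)$ for some $m \geq 1$ and some skewfield $D$; let $F$ be the centre of $D$ (a finite field extension of $\mathbb{Q}_p$), and let $s$ be the Schur index of $D$, so that $[D:F]=s^2$. For $\chi \in \mathrm{Irr}_{\mathbb{C}_p}(G)$ put $e_\chi = \chi(1)|G|^{-1}\sum_{g\in G}\chi(g^{-1})g \in \mathbb{C}_p[G]$, and let $\mathcal{C} \subseteq \mathrm{Irr}_{\mathbb{C}_p}(G)$ be the Galois conjugacy class (over $\mathbb{Q}_p$) of irreducible characters such that $e=\sum_{\chi\in\mathcal{C}} e_\chi$. Let $v_p$ denote the $p$-adic valuation. Then the following are equivalent: \begin{enumerate} \item $e \in \mathbb{Z}_p[G]$; \item $e \in \mathbb{Z}_p[G]$ and $\mathbb{Z}_p[G]e$ is a maximal $\mathbb{Z}_p$-order in $\mathbb{Q}_p[G]e$; \item $e \in \mathbb{Z}_p[G]$ and $F/\mathbb{Q}_p$ is unramified; \item $v_p(\chi(1)) = v_p(|G|)$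 for some $\chi \in \mathcal{C}$; \item $v_p(\chi(1)) = v_p(|G|)$ for every $\chi \in \mathcal{C}$. \end{enumerate} Furthermore, if these equivalent conditions hold then $s = 1$. -/

import Mathlib

open scoped MonoidAlgebra

noncomputable section

/-! ### Central primitive idempotents and the algebra `A e` -/

/-- `e` is a central primitive idempotent of the ring `A`: a nonzero central idempotent such that
the only central idempotents `f` with `f e = f` are `0` and `e`
(equivalently, `e` is not a sum of two nonzero orthogonal central idempotents). -/
structure IsCentralPrimitiveIdempotent {A : Type*} [Ring A] (e : A) : Prop where
  idem : IsIdempotentElem e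
  central : ∀ a : A, e * a = a * e
  ne_zero : e ≠ 0
  primitive : ∀ f : A, IsIdempotentElem f → (∀ a : A, f * a = a * f) → f * e = f → f = 0 ∨ f = e

section Corner

variable {R A : Type*} [CommRing R] [Ring A] [Algebra R A] {e : A}

/-- For an idempotent `e` of an `R`-algebra `A`, the ring `e A e` (with identity `e`) is an
`R`-algebra; the scalar action is the one of `A`. If `e` is central, then `e A e = A e`. -/
instance cornerAlgebra (idem : IsIdempotentElem e) : Algebra R idem.Corner where
  smul r x := ⟨r • x.1, (Subsemigroup.mem_corner_iff idem).2 (by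
    have h := (Subsemigroup.mem_corner_iff idem).1 x.2
    rw [mul_smul_comm, smul_mul_assoc, h.1, h.2]
    exact ⟨rfl, rfl⟩)⟩
  algebraMap :=
    { toFun := fun r => ⟨r • e, (Subsemigroup.mem_corner_iff idem).2 (by
        rw [mul_smul_comm, smul_mul_assoc, idem.eq]
        exact ⟨rfl, rfl⟩)⟩
      map_one' := Subtype.ext (one_smul R e)
      map_mul' := fun r s => Subtype.ext (by
        change (r * s) • e = (r • e) * (s • e)
        rw [smul_mul_smul_comm, idem.eq])
      map_zero' := Subtype.ext (zero_smul R e)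
      map_add' := fun r s => Subtype.ext (add_smul r s e) }
  commutes' r x := Subtype.ext (by
    have h := (Subsemigroup.mem_corner_iff idem).1 x.2
    change (r • e) * x.1 = x.1 * (r • e)
    rw [mul_smul_comm, smul_mul_assoc, h.1, h.2])
  smul_def' r x := Subtype.ext (by
    have h := (Subsemigroup.mem_corner_iff idem).1 x.2
    change r • x.1 = (r • e) * x.1
    rw [smul_mul_assoc, h.1])

instance cornerIsScalarTower {K : Type*} [CommRing K] [Algebra R K] [Algebra K A]
    [IsScalarTower R K A] (idem : IsIdempotentElem e) : IsScalarTower R K idem.Corner where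
  smul_assoc r k x := Subtype.ext (smul_assoc r k x.1)

variable (R) in
/-- The projection `A → A e`, `x ↦ x e`, for a central idempotent `e` of the `R`-algebra `A`. -/
def toCorner (idem : IsIdempotentElem e) (central : ∀ a : A, e * a = a * e) :
    A →ₐ[R] idem.Corner where
  toFun x := ⟨x * e, (Subsemigroup.mem_corner_iff idem).2 (by
    refine ⟨?_, ?_⟩
    · rw [← mul_assoc, central x, mul_assoc, idem.eq]
    · rw [mul_assoc, idem.eq])⟩
  map_one' := Subtype.ext (one_mul e)
  map_mul' x y := Subtype.ext (by
    change x * y * e = (x * e) * (y * e)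
    rw [mul_assoc x e, ← mul_assoc e y e, central y, mul_assoc y e e, idem.eq, mul_assoc])
  map_zero' := Subtype.ext (zero_mul e)
  map_add' x y := Subtype.ext (add_mul x y e)
  commutes' r := Subtype.ext (by
    change algebraMap R A r * e = r • e
    rw [Algebra.smul_def])

end Corner

/-! ### Orders -/

section Orders

variable (R K : Type*) {B : Type*} [CommRing R] [Field K] [Ring B] [Algebra R B] [Algebra K B]

/-- `Λ` is an `R`-order in the `K`-algebra `B` (where `K` is the field of fractions of `R`):
a subring which is a finitely generated `R`-module and spans `B` over `K`. -/
structure IsFullOrder (Λ : Subalgebra R B) : Prop where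
  fg : (Subalgebra.toSubmodule Λ).FG
  span_eq_top : Submodule.span K (Λ : Set B) = ⊤

/-- `Λ` is a maximal `R`-order in the `K`-algebra `B`. -/
def IsMaximalOrder (Λ : Subalgebra R B) : Prop :=
  IsFullOrder R K Λ ∧ ∀ Γ : Subalgebra R B, IsFullOrder R K Γ → Λ ≤ Γ → Γ = Λ

end Orders

/-! ### Schur index and unramified extensions -/

/-- `s` is the Schur index of the division algebra `D` over `K`:
`[D : F] = s ^ 2`, where `F` is the centre of `D`. -/
def IsSchurIndex (K D : Type*) [Field K] [DivisionRing D] [Algebra K D] (s : ℕ) : Prop :=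
  Module.finrank (Subalgebra.center K D) D = s ^ 2

section Padic

variable (p : ℕ) [Fact p.Prime]

/-- For a finite field extension `F / ℚ_p`: it is unramified, i.e. the integral closure of `ℤ_p`
in `F` is an unramified `ℤ_p`-algebra. -/
def IsUnramifiedOverPadic (F : Type*) [CommRing F] [Algebra ℚ_[p] F] : Prop :=
  letI : Algebra ℤ_[p] F := Algebra.compHom F (algebraMap ℤ_[p] ℚ_[p])
  Algebra.Unramified ℤ_[p] (integralClosure ℤ_[p] F)

/-! ### The `p`-adic group ring and characters -/

variable (G : Type*) [Group G]

/-- `ℤ_p[G]` as a `ℤ_p`-subalgebra of `ℚ_p[G]`. -/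
def integralGroupRing : Subalgebra ℤ_[p] ℚ_[p][G] :=
  (MonoidAlgebra.mapAlgHom G (Algebra.ofId ℤ_[p] ℚ_[p])).range

variable {G} in
/-- `ℤ_p[G] e` as a `ℤ_p`-subalgebra of `ℚ_p[G] e`, for a central idempotent `e`. -/
def integralGroupRingMul {e : ℚ_[p][G]} (he : IsCentralPrimitiveIdempotent e) :
    Subalgebra ℤ_[p] he.idem.Corner :=
  (integralGroupRing p G).map (toCorner ℤ_[p] he.idem he.central)

/-- `Irr_{ℂ_p}(G)`: the set of characters of the irreducible representations of the finite group
`G` on finite-dimensional `ℂ_p`-vector spaces. -/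
def irrCharacters : Set (G → ℂ_[p]) :=
  {χ | ∃ (n : ℕ) (ρ : Representation ℂ_[p] G (Fin n → ℂ_[p])),
    ρ.IsIrreducible ∧ ρ.character = χ}

variable {G}

/-- `e_χ = χ(1) |G|⁻¹ ∑_g χ(g⁻¹) g` in `ℂ_p[G]`. -/
def charIdempotent [Fintype G] (χ : G → ℂ_[p]) : ℂ_[p][G] :=
  ∑ g : G, MonoidAlgebra.single g (χ 1 * (Fintype.card G : ℂ_[p])⁻¹ * χ g⁻¹)

/-- The Galois conjugacy class of `χ`: all `σ ∘ χ` with `σ` an automorphism of `ℂ_p` over `ℚ_p`. -/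
def galoisClass (χ : G → ℂ_[p]) : Set (G → ℂ_[p]) :=
  Set.range fun (σ : ℂ_[p] ≃ₐ[ℚ_[p]] ℂ_[p]) (g : G) => σ (χ g)

/-- The class `C` of irreducible characters attached to a central primitive idempotent `e` of
`ℚ_p[G]`: `χ` belongs to it if `e = ∑ e_ψ`, the sum being over the Galois conjugates `ψ` of `χ`.
(There are only finitely many irreducible characters, so the sum is finite.) -/
def characterClass [Fintype G] (e : ℚ_[p][G]) : Set (G → ℂ_[p]) :=
  {χ | χ ∈ irrCharacters p G ∧
    MonoidAlgebra.mapAlgHom G (Algebra.ofId ℚ_[p] ℂ_[p]) e =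
      ∑ᶠ ψ ∈ galoisClass p χ, charIdempotent p ψ}

/-- `v_p(χ(1)) = v_p(|G|)`, where `χ(1)` is the natural number `d`. -/
def HasFullDegreeValuation [Fintype G] (χ : G → ℂ_[p]) : Prop :=
  ∃ d : ℕ, χ 1 = (d : ℂ_[p]) ∧ padicValNat p d = padicValNat p (Fintype.card G)

end Padic

end

/-! Conditions 2 and 3 contain condition 1, so the substance is the equivalence of 1, 4 and 5,
together with what full degree valuation implies. Everything rests on the formula e(g) = χ(1)/|G| ·
Σ ψ(g⁻¹), where ψ runs over the Galois conjugates of χ. A class of characters with this property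
exists by `nonempty_characterClass`.

If v_p(χ(1)) = v_p(|G|), integrality of character values makes e integral. Conversely, let e be
integral and let u have order p. Write d, a, s for the dimensions of ℚ_p[G]e, of its vectors fixed
by u on the left, and of those fixed by u on both sides. In M_m(D) the average over ⟨u⟩ becomes an
idempotent matrix, and comparing ranks gives a² = sd (`finrank_constOnFixed_sq`). Fixed vectors are
functions constant on cosets or double cosets, so for integral e the three dimensions survive
reduction modulo p (`finrank_constOnFixed_reduce_eq`). Over 𝔽_p the reduced block is free over
𝔽_p⟨u⟩ for left multiplication, so d = pa and hence d = p²s; this count forces freeness for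
conjugation by u as well. The reduction of e, being fixed by conjugation, is therefore a norm Σ uⁱ y
u⁻ⁱ (`exists_eq_sum_conj`), and p divides e(g) as soon as g commutes with an element of order p
(`dvd_coeff_of_commute`). In χ(1) = Σ e(g)χ(g) such g contribute pωχ(1) with ω integral. The other g
lie in classes whose length carries the full p-part of |G|, so this p-part divides χ(1). If
v_p(χ(1)) were larger than v_p(|G|), the powers of e would tend to 0, although e is a nonzero
idempotent.

Under full degree valuation χ(1)/|G| is a p-adic unit, and ℤ_p[G]e is self-dual for the trace form Σ
ψ (`norm_coeff_eq_norm_sum_charEval`). An element of ℚ_p[G]e with integral traces against G lies in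
ℤ_p[G], which gives maximality. If those traces have norm less than 1, the element lies in pℤ_p[G];
thus a right ideal that is nil modulo p vanishes modulo p. Applied to the centre, this makes O_F/p
reduced, so F is unramified. Applied below a minimal idempotent f, it makes f ℤ_p[G] f modulo p a
finite domain, hence a field. Then f ℤ_p[G] f is commutative, and so is D. -/

open Module

/-! ### Kernels of nilpotent endomorphisms -/

section Nilpotent

variable {K V : Type*} [Field K] [AddCommGroup V] [Module K V] [FiniteDimensional K V]

/-- Rank-nullity for `T ^ i` restricted to the kernel of `T ^ (i + 1)`: its kernel is that of `T ^
i`, its image is the intersection on the right. -/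
theorem finrank_ker_pow_succ (T : End K V) (i : ℕ) :
    finrank K (LinearMap.ker (T ^ (i + 1))) =
      finrank K (LinearMap.ker (T ^ i)) +
        finrank K (LinearMap.ker T ⊓ LinearMap.range (T ^ i) : Submodule K V) := by
  let f : LinearMap.ker (T ^ (i + 1)) →ₗ[K] V := (T ^ i).domRestrict _
  have hr : LinearMap.range f = LinearMap.ker T ⊓ LinearMap.range (T ^ i) := by
    ext y
    constructor
    · rintro ⟨⟨x, hx⟩, rfl⟩
      refine ⟨?_, x, rfl⟩
      rw [LinearMap.mem_ker, pow_succ', Module.End.mul_apply] at hx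
      exact hx
    · rintro ⟨hy, x, rfl⟩
      refine ⟨⟨x, ?_⟩, rfl⟩
      rw [LinearMap.mem_ker, pow_succ', Module.End.mul_apply]
      exact hy
  have hk : finrank K (LinearMap.ker f) = finrank K (LinearMap.ker (T ^ i)) := by
    have hle : LinearMap.ker (T ^ i) ≤ LinearMap.ker (T ^ (i + 1)) := fun x hx => by
      rw [LinearMap.mem_ker] at hx ⊢
      rw [pow_succ', Module.End.mul_apply, hx, map_zero]
    have : LinearMap.ker f = (LinearMap.ker (T ^ i)).comap (LinearMap.ker (T ^ (i + 1))).subtype := by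
      ext x; rfl
    rw [this]
    exact (Submodule.comapSubtypeEquivOfLe hle).finrank_eq
  rw [← LinearMap.finrank_range_add_finrank_ker f, hr, hk, add_comm]

theorem finrank_ker_pow_eq_sum (T : End K V) (n : ℕ) :
    finrank K (LinearMap.ker (T ^ n)) =
      ∑ i ∈ Finset.range n,
        finrank K (LinearMap.ker T ⊓ LinearMap.range (T ^ i) : Submodule K V) := by
  induction n with
  | zero =>
    have : LinearMap.ker (T ^ 0) = ⊥ := LinearMap.ker_eq_bot.mpr fun _ _ h => h
    rw [this]; simp
  | succ n ih => rw [finrank_ker_pow_succ, ih, Finset.sum_range_succ]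

theorem finrank_eq_sum_of_pow_eq_zero {T : End K V} {n : ℕ} (hT : T ^ n = 0) :
    finrank K V = ∑ i ∈ Finset.range n,
        finrank K (LinearMap.ker T ⊓ LinearMap.range (T ^ i) : Submodule K V) := by
  rw [← finrank_ker_pow_eq_sum, hT, LinearMap.ker_zero, finrank_top]

theorem finrank_le_mul_finrank_ker {T : End K V} {n : ℕ} (hT : T ^ n = 0) :
    finrank K V ≤ n * finrank K (LinearMap.ker T) := by
  rw [finrank_eq_sum_of_pow_eq_zero hT]
  calc _ ≤ ∑ i ∈ Finset.range n, finrank K (LinearMap.ker T) :=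
        Finset.sum_le_sum fun i _ => Submodule.finrank_mono inf_le_left
    _ = _ := by simp

/-- Equality in the kernel bound means that every Jordan block has the maximal size n + 1. For T = u
- 1 with u of order p in characteristic p, this expresses freeness over the group algebra of ⟨u⟩. -/
theorem ker_le_range_pow_of_finrank_eq {T : End K V} {n : ℕ} (hT : T ^ (n + 1) = 0)
    (h : finrank K V = (n + 1) * finrank K (LinearMap.ker T)) :
    LinearMap.ker T ≤ LinearMap.range (T ^ n) := by
  by_contra hc
  have hlt : finrank K (LinearMap.ker T ⊓ LinearMap.range (T ^ n) : Submodule K V) <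
      finrank K (LinearMap.ker T) :=
    Submodule.finrank_lt_finrank_of_lt (lt_of_le_of_ne inf_le_left fun h => hc (inf_eq_left.mp h))
  have : finrank K V < ∑ i ∈ Finset.range (n + 1), finrank K (LinearMap.ker T) := by
    rw [finrank_eq_sum_of_pow_eq_zero hT]
    exact Finset.sum_lt_sum (fun i _ => Submodule.finrank_mono inf_le_left)
      ⟨n, by simp, hlt⟩
  simp [h] at this

theorem finrank_eq_mul_of_ker_le_range_pow {T : End K V} {n : ℕ} (hT : T ^ (n + 1) = 0)
    (h : LinearMap.ker T ≤ LinearMap.range (T ^ n)) :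
    finrank K V = (n + 1) * finrank K (LinearMap.ker T) := by
  rw [finrank_eq_sum_of_pow_eq_zero hT]
  rw [Finset.sum_congr rfl fun i hi => ?_, Finset.sum_const, Finset.card_range, smul_eq_mul]
  have hle : LinearMap.range (T ^ n) ≤ LinearMap.range (T ^ i) := by
    obtain ⟨j, hj⟩ := Nat.exists_eq_add_of_le (Nat.lt_succ_iff.mp (Finset.mem_range.mp hi))
    rw [hj, pow_add]
    exact LinearMap.range_comp_le_range _ _
  rw [inf_eq_left.mpr (h.trans hle)]

end Nilpotent

/-! ### Idempotent matrices over a division algebra -/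

section IdempotentMatrix

variable {K D : Type*} [Field K] [DivisionRing D] [Algebra K D] {m : ℕ}

theorem exists_factorization_of_isIdempotentElem {P : Matrix (Fin m) (Fin m) D}
    (hP : IsIdempotentElem P) :
    ∃ (r : ℕ) (B : Matrix (Fin m) (Fin r) D) (C : Matrix (Fin r) (Fin m) D),
      P = B * C ∧ C * B = 1 := by
  classical
  let f : (Fin m → D) →ₗ[D] (Fin m → D) := P.toLinearMapRight'
  have hff : f ∘ₗ f = f := by
    change P.toLinearMapRight' ∘ₗ P.toLinearMapRight' = P.toLinearMapRight'
    rw [← Matrix.toLinearMapRight'_mul, hP.eq]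
  let b := Module.finBasis D (LinearMap.range f)
  let φ : LinearMap.range f ≃ₗ[D] (Fin _ → D) := b.equivFun
  let β : (Fin m → D) →ₗ[D] (Fin _ → D) := φ.toLinearMap ∘ₗ f.rangeRestrict
  let γ : (Fin (finrank D (LinearMap.range f)) → D) →ₗ[D] (Fin m → D) :=
    (LinearMap.range f).subtype ∘ₗ φ.symm.toLinearMap
  have h1 : γ ∘ₗ β = f := by ext x; simp [γ, β]
  have h2 : β ∘ₗ γ = LinearMap.id := by
    refine LinearMap.ext fun x => ?_
    have hx : f.rangeRestrict (φ.symm x : Fin m → D) = φ.symm x := by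
      obtain ⟨y, hy⟩ := (φ.symm x).2
      apply Subtype.ext
      rw [LinearMap.codRestrict_apply, ← hy]
      exact LinearMap.congr_fun hff y
    change φ (f.rangeRestrict (φ.symm x : Fin m → D)) = x
    rw [hx, LinearEquiv.apply_symm_apply]
  refine ⟨_, β.toMatrixRight', γ.toMatrixRight', ?_, ?_⟩
  · rw [← LinearMap.toMatrixRight'_comp, h1]
    exact (LinearEquiv.apply_symm_apply LinearMap.toMatrixRight' P).symm
  · rw [← LinearMap.toMatrixRight'_comp, h2, LinearMap.toMatrixRight'_id]

/-- Write P = BC with CB = 1 of size r. Then z ↦ Cz and z ↦ CzB identify the two fixed spaces with r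
× m and r × r matrices, so the dimensions are rm, r² and m² times [D : K]. -/
theorem finrank_fixed_sq_of_isIdempotentElem {P : Matrix (Fin m) (Fin m) D}
    (hP : IsIdempotentElem P) (U W : Submodule K (Matrix (Fin m) (Fin m) D))
    (hU : ∀ z, z ∈ U ↔ P * z = z) (hW : ∀ z, z ∈ W ↔ P * z = z ∧ z * P = z) :
    finrank K U ^ 2 = finrank K W * finrank K (Matrix (Fin m) (Fin m) D) := by
  obtain ⟨r, B, C, rfl, hCB⟩ := exists_factorization_of_isIdempotentElem hP
  let eU : U ≃ₗ[K] Matrix (Fin r) (Fin m) D :=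
    { toFun := fun z => C * z.1
      map_add' := fun x y => Matrix.mul_add _ _ _
      map_smul' := fun c x => Matrix.mul_smul _ _ _
      invFun := fun w => ⟨B * w, (hU _).mpr (by
        rw [Matrix.mul_assoc, ← Matrix.mul_assoc C, hCB, Matrix.one_mul])⟩
      left_inv := fun z => Subtype.ext (by
        have := (hU _).mp z.2
        rwa [Matrix.mul_assoc] at this)
      right_inv := fun w => by
        change C * (B * w) = w
        rw [← Matrix.mul_assoc, hCB, Matrix.one_mul] }
  let eW : W ≃ₗ[K] Matrix (Fin r) (Fin r) D :=
    { toFun := fun z => C * z.1 * B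
      map_add' := fun x y => by simp [Matrix.mul_add, Matrix.add_mul]
      map_smul' := fun c x => by simp
      invFun := fun w => ⟨B * w * C, (hW _).mpr (by
        constructor
        · rw [Matrix.mul_assoc B C, ← Matrix.mul_assoc C, ← Matrix.mul_assoc C, hCB,
            Matrix.one_mul, Matrix.mul_assoc]
        · rw [Matrix.mul_assoc _ C, ← Matrix.mul_assoc C, hCB, Matrix.one_mul])⟩
      left_inv := fun z => Subtype.ext (by
        have h := (hW _).mp z.2
        calc B * (C * z.1 * B) * C = (B * C * z.1) * (B * C) := by simp only [Matrix.mul_assoc]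
          _ = z.1 := by rw [h.1, h.2])
      right_inv := fun w => by
        change C * (B * w * C) * B = w
        calc C * (B * w * C) * B = (C * B) * w * (C * B) := by simp only [Matrix.mul_assoc]
          _ = w := by rw [hCB, Matrix.one_mul, Matrix.mul_one] }
  rw [eU.finrank_eq, eW.finrank_eq, Module.finrank_matrix, Module.finrank_matrix,
    Module.finrank_matrix]
  simp only [Fintype.card_fin]
  ring

end IdempotentMatrix

/-! ### Reduction modulo p of the integral group ring -/

section Reduction

variable {p : ℕ} [Fact p.Prime] {G : Type*} [Group G]

variable (p G) in
/-- Reduction modulo `p` of the coefficients of an element of `ℤ_p[G]`. -/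
noncomputable abbrev reduceCoeff : ℤ_[p][G] →+* (ZMod p)[G] :=
  MonoidAlgebra.mapRingHom G PadicInt.toZMod

variable (p G) in
/-- The inclusion of `ℤ_p[G]` in `ℚ_p[G]`. -/
noncomputable abbrev includeCoeff : ℤ_[p][G] →+* ℚ_[p][G] :=
  MonoidAlgebra.mapRingHom G (algebraMap ℤ_[p] ℚ_[p])

theorem PadicInt.toZMod_eq_zero_iff {x : ℤ_[p]} :
    PadicInt.toZMod x = 0 ↔ (p : ℤ_[p]) ∣ x := by
  rw [← RingHom.mem_ker, PadicInt.ker_toZMod, PadicInt.maximalIdeal_eq_span_p,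
    Ideal.mem_span_singleton]

theorem PadicInt.eq_zero_of_forall_pow_dvd {x : ℤ_[p]} (h : ∀ n : ℕ, (p : ℤ_[p]) ^ n ∣ x) :
    x = 0 := by
  have hI := Ideal.iInf_pow_eq_bot_of_isLocalRing (IsLocalRing.maximalIdeal ℤ_[p])
    (IsLocalRing.maximalIdeal.isMaximal _).ne_top
  rw [← Ideal.mem_bot, ← hI, Submodule.mem_iInf]
  intro n
  rw [PadicInt.maximalIdeal_eq_span_p, Ideal.span_singleton_pow, Ideal.mem_span_singleton]
  exact h n

theorem includeCoeff_injective : Function.Injective (includeCoeff p G) := by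
  intro x y h
  ext g
  have := congrArg (fun z => z.coeff g) h
  simp only [MonoidAlgebra.coeff_mapRingHom] at this
  exact IsFractionRing.injective ℤ_[p] ℚ_[p] this

theorem reduceCoeff_eq_zero_iff {x : ℤ_[p][G]} :
    reduceCoeff p G x = 0 ↔ ∃ y : ℤ_[p][G], x = (p : ℤ_[p]) • y := by
  constructor
  · intro h
    have hd : ∀ g, ∃ b : ℤ_[p], x.coeff g = p * b := fun g => by
      have := congrArg (fun z => z.coeff g) h
      rw [MonoidAlgebra.coeff_mapRingHom] at this
      exact PadicInt.toZMod_eq_zero_iff.mp this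
    choose b hb using hd
    classical
    refine ⟨MonoidAlgebra.ofCoeff (Finsupp.onFinset x.coeff.support b fun g hg => ?_), ?_⟩
    · rw [Finsupp.mem_support_iff, hb]
      exact mul_ne_zero (by exact_mod_cast (Fact.out : p.Prime).ne_zero) hg
    · ext g
      simp [hb g]
  · rintro ⟨y, rfl⟩
    ext g
    simp

/-- A relation may be taken over ℤ_p. Reduction shows that its coefficients are divisible by p;
dividing by p yields another relation, so the coefficients are infinitely divisible and vanish. -/
theorem linearIndependent_includeCoeff {ι : Type*} [Finite ι] {v : ι → ℤ_[p][G]}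
    (hv : LinearIndependent (ZMod p) fun i => reduceCoeff p G (v i)) :
    LinearIndependent ℚ_[p] fun i => includeCoeff p G (v i) := by
  have := Fintype.ofFinite ι
  rw [← LinearIndependent.iff_fractionRing ℤ_[p] ℚ_[p], Fintype.linearIndependent_iff]
  intro a ha
  have ha' : ∑ i, a i • v i = 0 := by
    apply includeCoeff_injective
    rw [map_zero, ← ha, map_sum]
    refine Finset.sum_congr rfl fun i _ => ?_
    ext g
    simp [Algebra.smul_def]
  have key : ∀ (n : ℕ) (a : ι → ℤ_[p]), ∑ i, a i • v i = 0 → ∀ i, (p : ℤ_[p]) ^ n ∣ a i := by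
    intro n
    induction n with
    | zero => simp
    | succ n ih =>
      intro a ha
      have h0 : ∑ i, PadicInt.toZMod (a i) • reduceCoeff p G (v i) = 0 := by
        rw [← map_zero (reduceCoeff p G), ← ha, map_sum]
        refine Finset.sum_congr rfl fun i _ => ?_
        ext g
        simp
      have h1 : ∀ i, ∃ b, a i = p * b := fun i =>
        PadicInt.toZMod_eq_zero_iff.mp (Fintype.linearIndependent_iff.mp hv _ h0 i)
      choose b hb using h1
      have hb0 : ∑ i, b i • v i = 0 := by
        have h2 : (p : ℤ_[p]) • ∑ i, b i • v i = 0 := by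
          rw [Finset.smul_sum, ← ha]
          exact Finset.sum_congr rfl fun i _ => by rw [smul_smul, hb]
        ext g
        have := congrArg (fun z => z.coeff g) h2
        simpa [(Fact.out : p.Prime).ne_zero] using this
      intro i
      rw [hb, pow_succ']
      exact mul_dvd_mul_left _ (ih b hb0 i)
  exact fun i => PadicInt.eq_zero_of_forall_pow_dvd fun n => key n a ha' i

end Reduction

/-! ### Functions constant on classes, and dimensions under reduction -/

section ConstOn

variable {G : Type*} [Group G] [Finite G]

/-- The elements of `k[G]` whose coefficients are constant on the classes of `s`. -/
def constOn (k : Type*) [CommRing k] (s : Setoid G) : Submodule k k[G] where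
  carrier := {z | ∀ a b, s a b → z.coeff a = z.coeff b}
  add_mem' hx hy a b h := by
    rw [MonoidAlgebra.coeff_add, Finsupp.add_apply, Finsupp.add_apply, hx a b h, hy a b h]
  zero_mem' _ _ _ := rfl
  smul_mem' c x hx a b h := by
    rw [MonoidAlgebra.coeff_smul_apply, MonoidAlgebra.coeff_smul_apply, hx a b h]

omit [Group G] in
theorem finrank_constOn (k : Type*) [Field k] (s : Setoid G) :
    finrank k (constOn k s) = Nat.card (Quotient s) := by
  have := Fintype.ofFinite (Quotient s)
  let f : constOn k s ≃ₗ[k] (Quotient s → k) :=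
    { toFun := fun z => Quotient.lift z.1.coeff z.2
      map_add' := fun x y => by ext ⟨q⟩; rfl
      map_smul' := fun c x => by ext ⟨q⟩; rfl
      invFun := fun w => ⟨MonoidAlgebra.ofCoeff (Finsupp.equivFunOnFinite.symm fun g => w ⟦g⟧),
        fun a b h => by
          have : (⟦a⟧ : Quotient s) = ⟦b⟧ := Quotient.sound h
          simp [this]⟩
      left_inv := fun z => by
        apply Subtype.ext
        ext g
        rfl
      right_inv := fun w => by ext ⟨q⟩; rfl }
  rw [f.finrank_eq, Module.finrank_fintype_fun_eq_card, Nat.card_eq_fintype_card]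

instance MonoidAlgebra.finiteDimensional (k : Type*) [Field k] : FiniteDimensional k k[G] :=
  Module.Finite.of_basis (MonoidAlgebra.basis G k)

/-- The elements of `constOn k s` fixed by left multiplication by `e`. -/
def constOnFixed {k : Type*} [CommRing k] (s : Setoid G) (e : k[G]) : Submodule k k[G] where
  carrier := {z | z ∈ constOn k s ∧ e * z = z}
  add_mem' hx hy := ⟨add_mem hx.1 hy.1, by rw [mul_add, hx.2, hy.2]⟩
  zero_mem' := ⟨zero_mem _, mul_zero _⟩
  smul_mem' c x hx := ⟨Submodule.smul_mem _ c hx.1, by rw [mul_smul_comm, hx.2]⟩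

theorem finrank_constOnFixed_add {k : Type*} [Field k] {s : Setoid G} {e : k[G]}
    (he : IsIdempotentElem e) (hs : ∀ z ∈ constOn k s, e * z ∈ constOn k s) :
    finrank k (constOnFixed s e) + finrank k (constOnFixed s (1 - e)) = Nat.card (Quotient s) := by
  rw [← finrank_constOn k s]
  have h1 : constOnFixed s e ⊔ constOnFixed s (1 - e) = constOn k s := by
    apply le_antisymm
    · exact sup_le (fun z hz => hz.1) fun z hz => hz.1
    · intro z hz
      refine Submodule.mem_sup.mpr ⟨e * z, ⟨hs z hz, by rw [← mul_assoc, he.eq]⟩, z - e * z,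
        ⟨sub_mem hz (hs z hz), ?_⟩, by abel⟩
      have : e * (z - e * z) = 0 := by rw [mul_sub, ← mul_assoc, he.eq, sub_self]
      rw [sub_mul, one_mul, this, sub_zero]
  have h2 : constOnFixed s e ⊓ constOnFixed s (1 - e) = ⊥ := by
    rw [eq_bot_iff]
    rintro z ⟨⟨_, hz⟩, ⟨_, hz'⟩⟩
    rw [sub_mul, one_mul, hz, sub_self] at hz'
    exact hz'.symm
  rw [← Submodule.finrank_sup_add_finrank_inf_eq, h1, h2, finrank_bot, add_zero]

variable {p : ℕ} [Fact p.Prime]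

/-- Lift a basis of the reduced space to ℤ_p[G] and multiply by e: the results still reduce to the
basis, hence stay independent over ℚ_p. -/
theorem finrank_constOnFixed_reduce_le {s : Setoid G} {e : ℤ_[p][G]} (he : IsIdempotentElem e)
    (hs : ∀ z ∈ constOn ℚ_[p] s, includeCoeff p G e * z ∈ constOn ℚ_[p] s) :
    finrank (ZMod p) (constOnFixed s (reduceCoeff p G e)) ≤
      finrank ℚ_[p] (constOnFixed s (includeCoeff p G e)) := by
  let b := Module.finBasis (ZMod p) (constOnFixed s (reduceCoeff p G e))
  -- One set-theoretic section serves all coefficients, so the lifts remain constant on the classes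
  -- of `s`.
  obtain ⟨t, ht⟩ := (ZMod.ringHom_surjective (PadicInt.toZMod (p := p))).hasRightInverse
  let c (i) : ℤ_[p][G] :=
    MonoidAlgebra.ofCoeff (Finsupp.equivFunOnFinite.symm fun g => t ((b i).1.coeff g))
  have hc (i) : reduceCoeff p G (c i) = (b i).1 := by
    ext g
    rw [MonoidAlgebra.coeff_mapRingHom]
    exact ht _
  have hred (i) : reduceCoeff p G (e * c i) = (b i).1 := by
    rw [map_mul, hc, (b i).2.2]
  have hli : LinearIndependent (ZMod p) fun i => reduceCoeff p G (e * c i) := by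
    simp only [hred]
    exact b.linearIndependent.map' (Submodule.subtype _) (Submodule.ker_subtype _)
  have hmem (i) : includeCoeff p G (e * c i) ∈ constOnFixed s (includeCoeff p G e) := by
    refine ⟨?_, by rw [← map_mul, ← mul_assoc, he.eq]⟩
    rw [map_mul]
    apply hs
    intro x y hxy
    simp [c, (b i).2.1 x y hxy]
  have h2 : LinearIndependent ℚ_[p] fun i =>
      (⟨_, hmem i⟩ : constOnFixed s (includeCoeff p G e)) :=
    LinearIndependent.of_comp (Submodule.subtype _) (linearIndependent_includeCoeff hli)
  simpa using h2.fintype_card_le_finrank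

/-- The inequality holds for e and for 1 - e, and in both characteristics the two dimensions add up
to the number of classes. Hence both inequalities are equalities. -/
theorem finrank_constOnFixed_reduce_eq {s : Setoid G} {e : ℤ_[p][G]} (he : IsIdempotentElem e)
    (hs : ∀ z ∈ constOn ℚ_[p] s, includeCoeff p G e * z ∈ constOn ℚ_[p] s)
    (hs' : ∀ z ∈ constOn (ZMod p) s, reduceCoeff p G e * z ∈ constOn (ZMod p) s) :
    finrank (ZMod p) (constOnFixed s (reduceCoeff p G e)) =
      finrank ℚ_[p] (constOnFixed s (includeCoeff p G e)) := by
  have h1 := finrank_constOnFixed_reduce_le he hs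
  have h2 := finrank_constOnFixed_reduce_le (s := s) he.one_sub fun z hz => by
    rw [map_sub, map_one, sub_mul, one_mul]
    exact sub_mem hz (hs z hz)
  rw [map_sub, map_one, map_sub, map_one] at h2
  have h3 := finrank_constOnFixed_add (he.map (reduceCoeff p G)) hs'
  have h4 := finrank_constOnFixed_add (he.map (includeCoeff p G)) hs
  omega

end ConstOn

/-! ### Nilpotent endomorphisms on an invariant subspace -/

section NilpotentOnSubmodule

variable {K V : Type*} [Field K] [AddCommGroup V] [Module K V]
  {M : Submodule K V} {T : End K V} {n : ℕ}

theorem finrank_ker_restrict (hM : ∀ z ∈ M, T z ∈ M) :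
    finrank K (LinearMap.ker (T.restrict hM)) =
      finrank K (M ⊓ LinearMap.ker T : Submodule K V) := by
  rw [LinearMap.ker_restrict, ← Submodule.map_comap_subtype]
  exact (Submodule.equivMapOfInjective M.subtype M.injective_subtype _).finrank_eq

theorem restrict_pow_eq_zero (hM : ∀ z ∈ M, T z ∈ M) (hT : T ^ n = 0) :
    (T.restrict hM) ^ n = 0 := by
  rw [Module.End.pow_restrict n hM]
  ext z
  rw [LinearMap.coe_restrict_apply, hT]
  rfl

variable [FiniteDimensional K V]

theorem finrank_submodule_le_mul (hM : ∀ z ∈ M, T z ∈ M) (hT : T ^ n = 0) :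
    finrank K M ≤ n * finrank K (M ⊓ LinearMap.ker T : Submodule K V) := by
  rw [← finrank_ker_restrict hM]
  exact finrank_le_mul_finrank_ker (restrict_pow_eq_zero hM hT)

theorem exists_pow_apply_eq_of_finrank_submodule_eq (hM : ∀ z ∈ M, T z ∈ M)
    (hT : T ^ (n + 1) = 0)
    (h : finrank K M = (n + 1) * finrank K (M ⊓ LinearMap.ker T : Submodule K V))
    {z : V} (hz : z ∈ M) (hTz : T z = 0) : ∃ y ∈ M, (T ^ n) y = z := by
  rw [← finrank_ker_restrict hM] at h
  have hz' : (⟨z, hz⟩ : M) ∈ LinearMap.ker (T.restrict hM) := Subtype.ext hTz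
  obtain ⟨y, hy⟩ := ker_le_range_pow_of_finrank_eq (restrict_pow_eq_zero hM hT) h hz'
  refine ⟨y.1, y.2, ?_⟩
  rw [Module.End.pow_restrict n hM] at hy
  exact congrArg Subtype.val hy

theorem finrank_submodule_eq_mul (hM : ∀ z ∈ M, T z ∈ M) (hT : T ^ (n + 1) = 0)
    (h : ∀ z ∈ M, T z = 0 → ∃ y ∈ M, (T ^ n) y = z) :
    finrank K M = (n + 1) * finrank K (M ⊓ LinearMap.ker T : Submodule K V) := by
  rw [← finrank_ker_restrict hM]
  refine finrank_eq_mul_of_ker_le_range_pow (restrict_pow_eq_zero hM hT) ?_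
  intro z hz
  obtain ⟨y, hy, hyz⟩ := h z.1 z.2 (congrArg Subtype.val hz)
  refine ⟨⟨y, hy⟩, ?_⟩
  rw [Module.End.pow_restrict n hM]
  exact Subtype.ext hyz

end NilpotentOnSubmodule

/-! ### Operators of order p in characteristic p -/

section CharP

variable {p : ℕ} [Fact p.Prime]

/-- In 𝔽_p[X], cancel X - 1 from (X - 1)^p = X^p - 1. Thus the norm of an operator of order p is the
top power of the nilpotent operator x - 1. -/
theorem sub_one_pow_pred_char {R : Type*} [Ring R] [Algebra (ZMod p) R] (x : R) :
    (x - 1) ^ (p - 1) = ∑ i ∈ Finset.range p, x ^ i := by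
  open Polynomial in
  have h : (X - 1 : (ZMod p)[X]) ^ (p - 1) = ∑ i ∈ Finset.range p, X ^ i := by
    have h0 : (X - 1 : (ZMod p)[X]) ≠ 0 := by
      rw [← C_1]; exact X_sub_C_ne_zero 1
    apply mul_left_cancel₀ h0
    rw [← pow_succ', Nat.sub_add_cancel (Fact.out : p.Prime).one_le, mul_geom_sum,
      sub_pow_expChar, one_pow]
  simpa using congrArg (Polynomial.aeval x) h

theorem sub_one_pow_char_eq_zero {R : Type*} [Ring R] [Algebra (ZMod p) R] {x : R}
    (hx : x ^ p = 1) : (x - 1) ^ (p - 1 + 1) = 0 := by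
  rw [pow_succ', sub_one_pow_pred_char, mul_geom_sum, hx, sub_self]

variable {G : Type*} [Group G] {u : G}

variable (p u) in
/-- Left multiplication by `u` on `𝔽_p[G]`. -/
noncomputable def leftMulEnd : End (ZMod p) (ZMod p)[G] :=
  LinearMap.mulLeft (ZMod p) (MonoidAlgebra.single u 1)

variable (p u) in
/-- Conjugation by `u` on `𝔽_p[G]`. -/
noncomputable def conjEnd : End (ZMod p) (ZMod p)[G] :=
  LinearMap.mulLeftRight (ZMod p) (MonoidAlgebra.single u 1, MonoidAlgebra.single u⁻¹ 1)

theorem leftMulEnd_apply (z : (ZMod p)[G]) :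
    leftMulEnd p u z = MonoidAlgebra.single u 1 * z := rfl

theorem conjEnd_apply (z : (ZMod p)[G]) :
    conjEnd p u z = MonoidAlgebra.single u 1 * z * MonoidAlgebra.single u⁻¹ 1 := rfl

theorem leftMulEnd_pow_apply (n : ℕ) (z : (ZMod p)[G]) :
    (leftMulEnd p u ^ n) z = MonoidAlgebra.single (u ^ n) 1 * z := by
  induction n with
  | zero => simp [← MonoidAlgebra.one_def]
  | succ n ih =>
    rw [pow_succ', Module.End.mul_apply, ih, leftMulEnd_apply, ← mul_assoc,
      MonoidAlgebra.single_mul_single, ← pow_succ', one_mul]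

theorem conjEnd_pow_apply (n : ℕ) (z : (ZMod p)[G]) :
    (conjEnd p u ^ n) z =
      MonoidAlgebra.single (u ^ n) 1 * z * MonoidAlgebra.single (u ^ n)⁻¹ 1 := by
  induction n with
  | zero => simp [← MonoidAlgebra.one_def]
  | succ n ih =>
    rw [pow_succ', Module.End.mul_apply, ih, conjEnd_apply, pow_succ' u, mul_inv_rev,
      ← mul_one (1 : ZMod p), ← MonoidAlgebra.single_mul_single,
      ← MonoidAlgebra.single_mul_single]
    simp only [mul_assoc, mul_one]

theorem leftMulEnd_pow_eq_one (hu : u ^ p = 1) : leftMulEnd p u ^ p = 1 := by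
  refine LinearMap.ext fun z => ?_
  rw [leftMulEnd_pow_apply, hu, ← MonoidAlgebra.one_def, one_mul]
  rfl

theorem conjEnd_pow_eq_one (hu : u ^ p = 1) : conjEnd p u ^ p = 1 := by
  refine LinearMap.ext fun z => ?_
  rw [conjEnd_pow_apply, hu, inv_one, ← MonoidAlgebra.one_def, one_mul, mul_one]
  rfl

end CharP

/-! ### Fixed vectors of a cyclic subgroup as functions constant on cosets -/

section InvariantsUnderCyclicSubgroup

variable {G : Type*} [Group G] {u : G}

theorem apply_mul_left_of_mem_zpowers {X : Type*} {f : G → X} (h : ∀ g, f (u * g) = f g) {a : G}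
    (ha : a ∈ Subgroup.zpowers u) (g : G) : f (a * g) = f g := by
  let S : Subgroup G :=
    { carrier := {a | ∀ g, f (a * g) = f g}
      one_mem' := fun g => by rw [one_mul]
      mul_mem' := fun {a b} ha hb g => by rw [mul_assoc, ha, hb]
      inv_mem' := fun {a} ha g => by rw [← ha, mul_inv_cancel_left] }
  have : Subgroup.zpowers u ≤ S := Subgroup.zpowers_le.mpr h
  exact this ha g

theorem apply_mul_right_of_mem_zpowers {X : Type*} {f : G → X} (h : ∀ g, f (g * u) = f g) {a : G}
    (ha : a ∈ Subgroup.zpowers u) (g : G) : f (g * a) = f g := by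
  let S : Subgroup G :=
    { carrier := {a | ∀ g, f (g * a) = f g}
      one_mem' := fun g => by rw [mul_one]
      mul_mem' := fun {a b} ha hb g => by rw [← mul_assoc, hb, ha]
      inv_mem' := fun {a} ha g => by rw [← ha, inv_mul_cancel_right] }
  have : Subgroup.zpowers u ≤ S := Subgroup.zpowers_le.mpr h
  exact this ha g

variable {k : Type*} [CommRing k] {z : k[G]}

/-- Describing fixed vectors by cosets makes them comparable over ℚ_p and over 𝔽_p. -/
theorem mem_constOn_rightRel_iff :
    z ∈ constOn k (QuotientGroup.rightRel (Subgroup.zpowers u)) ↔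
      MonoidAlgebra.single u 1 * z = z := by
  constructor
  · intro h
    ext g
    rw [MonoidAlgebra.coeff_single_mul_apply, one_mul]
    refine h _ _ (QuotientGroup.rightRel_apply.mpr ?_)
    simp
  · intro h a b hab
    have h1 : ∀ g, z.coeff (u * g) = z.coeff g := fun g => by
      conv_lhs => rw [← h]
      rw [MonoidAlgebra.coeff_single_mul_apply, one_mul, inv_mul_cancel_left]
    rw [← apply_mul_left_of_mem_zpowers h1 (QuotientGroup.rightRel_apply.mp hab) a,
      inv_mul_cancel_right]

theorem mem_constOn_doubleCoset_iff :
    z ∈ constOn k (DoubleCoset.setoid (Subgroup.zpowers u : Set G) (Subgroup.zpowers u)) ↔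
      MonoidAlgebra.single u 1 * z = z ∧ z * MonoidAlgebra.single u 1 = z := by
  constructor
  · intro h
    constructor
    · ext g
      rw [MonoidAlgebra.coeff_single_mul_apply, one_mul]
      exact h _ _ (DoubleCoset.rel_iff.mpr ⟨u, Subgroup.mem_zpowers u, 1, one_mem _, by simp⟩)
    · ext g
      rw [MonoidAlgebra.coeff_mul_single_apply, mul_one]
      exact h _ _ (DoubleCoset.rel_iff.mpr ⟨1, one_mem _, u, Subgroup.mem_zpowers u, by simp⟩)
  · rintro ⟨h, h'⟩ a b hab
    have h1 : ∀ g, z.coeff (u * g) = z.coeff g := fun g => by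
      conv_lhs => rw [← h]
      rw [MonoidAlgebra.coeff_single_mul_apply, one_mul, inv_mul_cancel_left]
    have h2 : ∀ g, z.coeff (g * u) = z.coeff g := fun g => by
      conv_lhs => rw [← h']
      rw [MonoidAlgebra.coeff_mul_single_apply, mul_one, mul_inv_cancel_right]
    obtain ⟨c, hc, d, hd, rfl⟩ := DoubleCoset.rel_iff.mp hab
    rw [apply_mul_right_of_mem_zpowers h2 hd, apply_mul_left_of_mem_zpowers h1 hc]

omit [Group G] in
theorem mem_constOn_bot : z ∈ constOn k (⊥ : Setoid G) := by
  rintro a b rfl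
  rfl

end InvariantsUnderCyclicSubgroup

/-! ### The dimension identity in the simple block -/

section PadicCorner

variable {p : ℕ} [Fact p.Prime] {G : Type*} [Group G] {e : ℚ_[p][G]}
  (idem : IsIdempotentElem e) {m : ℕ} {D : Type*} [DivisionRing D] [Algebra ℚ_[p] D]
  (φ : idem.Corner ≃ₐ[ℚ_[p]] Matrix (Fin m) (Fin m) D)

/-- The inclusion of the corner of an idempotent as a linear map. -/
def cornerSubtype {R A : Type*} [CommRing R] [Ring A] [Algebra R A] {e : A}
    (idem : IsIdempotentElem e) : idem.Corner →ₗ[R] A where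
  toFun := Subtype.val
  map_add' _ _ := rfl
  map_smul' _ _ := rfl

/-- An element `z = e z e` of `A` as an element of the corner of `e`. -/
def cornerMk {A : Type*} [Ring A] {e : A} (idem : IsIdempotentElem e) (z : A)
    (h : e * z = z ∧ z * e = z) : idem.Corner :=
  ⟨z, (Subsemigroup.mem_corner_iff idem).2 h⟩

variable (central : ∀ a, e * a = a * e) {u : G} (hu : orderOf u = p)

-- The average ε of the powers of u is idempotent, and being fixed by u on one side is being fixed
-- by ε there. The matrix of eε then has the stated spaces as its fixed spaces.
include φ central hu in
theorem finrank_constOnFixed_sq :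
    finrank ℚ_[p] (constOnFixed (QuotientGroup.rightRel (Subgroup.zpowers u)) e) ^ 2 =
      finrank ℚ_[p] (constOnFixed
        (DoubleCoset.setoid (Subgroup.zpowers u : Set G) (Subgroup.zpowers u)) e) *
      finrank ℚ_[p] (constOnFixed (⊥ : Setoid G) e) := by
  let θ : Matrix (Fin m) (Fin m) D →ₗ[ℚ_[p]] ℚ_[p][G] :=
    cornerSubtype idem ∘ₗ φ.symm.toLinearMap
  have hθ : Function.Injective θ := Subtype.val_injective.comp φ.symm.injective
  have hθe (x) : e * θ x = θ x :=
    ((Subsemigroup.mem_corner_iff idem).1 (φ.symm x).2).1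
  have hθm (x y) : θ (x * y) = θ x * θ y := congrArg Subtype.val (map_mul φ.symm x y)
  have hθs (z) (hz : e * z = z) : ∃ x, θ x = z := by
    let w : idem.Corner := cornerMk idem z ⟨hz, by rw [← central, hz]⟩
    exact ⟨φ w, congrArg Subtype.val (AlgEquiv.symm_apply_apply φ w)⟩
  have hcomap (S : Submodule ℚ_[p] ℚ_[p][G]) (hS : ∀ z ∈ S, e * z = z) :
      finrank ℚ_[p] (S.comap θ) = finrank ℚ_[p] S := by
    have hle : S ≤ LinearMap.range θ := fun z hz => hθs z (hS z hz)
    conv_rhs => rw [← Submodule.map_comap_eq_of_le hle]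
    exact (Submodule.equivMapOfInjective θ hθ _).finrank_eq
  let N : ℚ_[p][G] := ∑ i ∈ Finset.range p, MonoidAlgebra.single u 1 ^ i
  have hup : (MonoidAlgebra.single u 1 : ℚ_[p][G]) ^ p = 1 := by
    rw [MonoidAlgebra.single_pow, orderOf_dvd_iff_pow_eq_one.mp hu.dvd, one_pow,
      MonoidAlgebra.one_def]
  have hUN : MonoidAlgebra.single u 1 * N = N := by
    have := mul_geom_sum (MonoidAlgebra.single u 1 : ℚ_[p][G]) p
    rw [hup, sub_self, sub_mul, one_mul, sub_eq_zero] at this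
    exact this
  have hNU : N * MonoidAlgebra.single u 1 = N := by
    have := geom_sum_mul (MonoidAlgebra.single u 1 : ℚ_[p][G]) p
    rw [hup, sub_self, mul_sub, mul_one, sub_eq_zero] at this
    exact this
  have hp0 : (p : ℚ_[p]) ≠ 0 := by exact_mod_cast (Fact.out : p.Prime).ne_zero
  let ε : ℚ_[p][G] := (p : ℚ_[p])⁻¹ • N
  have hl (z : ℚ_[p][G]) : ε * z = z ↔ MonoidAlgebra.single u 1 * z = z := by
    constructor
    · intro h
      rw [← h, ← mul_assoc]
      congr 1
      rw [mul_smul_comm, hUN]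
    · intro h
      have h1 (i : ℕ) : MonoidAlgebra.single u 1 ^ i * z = z := by
        induction i with
        | zero => rw [pow_zero, one_mul]
        | succ i ih => rw [pow_succ, mul_assoc, h, ih]
      rw [smul_mul_assoc, Finset.sum_mul, Finset.sum_congr rfl fun i _ => h1 i, Finset.sum_const,
        Finset.card_range, ← Nat.cast_smul_eq_nsmul ℚ_[p], inv_smul_smul₀ hp0]
  have hr (z : ℚ_[p][G]) : z * ε = z ↔ z * MonoidAlgebra.single u 1 = z := by
    constructor
    · intro h
      rw [← h, mul_assoc]
      congr 1
      rw [smul_mul_assoc, hNU]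
    · intro h
      have h1 (i : ℕ) : z * MonoidAlgebra.single u 1 ^ i = z := by
        induction i with
        | zero => rw [pow_zero, mul_one]
        | succ i ih => rw [pow_succ', ← mul_assoc, h, ih]
      rw [mul_smul_comm, Finset.mul_sum, Finset.sum_congr rfl fun i _ => h1 i, Finset.sum_const,
        Finset.card_range, ← Nat.cast_smul_eq_nsmul ℚ_[p], inv_smul_smul₀ hp0]
  obtain ⟨P, hP⟩ := hθs (e * ε) (by rw [← mul_assoc, idem.eq])
  have hPl (z) : P * z = z ↔ MonoidAlgebra.single u 1 * θ z = θ z := by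
    rw [← hθ.eq_iff, hθm, hP, central, mul_assoc, hθe, hl]
  have hPr (z) : z * P = z ↔ θ z * MonoidAlgebra.single u 1 = θ z := by
    rw [← hθ.eq_iff, hθm, hP, ← mul_assoc, ← central, hθe, hr]
  have hPi : IsIdempotentElem P := by
    refine (hPl P).mpr ?_
    rw [hP, central, ← mul_assoc]
    congr 1
    rw [mul_smul_comm, hUN]
  have key := finrank_fixed_sq_of_isIdempotentElem hPi
    ((constOnFixed (QuotientGroup.rightRel (Subgroup.zpowers u)) e).comap θ)
    ((constOnFixed (DoubleCoset.setoid (Subgroup.zpowers u : Set G)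
      (Subgroup.zpowers u)) e).comap θ)
    (fun z => by
      rw [hPl]
      exact ⟨fun h => mem_constOn_rightRel_iff.mp h.1,
        fun h => ⟨mem_constOn_rightRel_iff.mpr h, hθe z⟩⟩)
    (fun z => by
      rw [hPl, hPr]
      exact ⟨fun h => mem_constOn_doubleCoset_iff.mp h.1,
        fun h => ⟨mem_constOn_doubleCoset_iff.mpr h, hθe z⟩⟩)
  have htop : (constOnFixed (⊥ : Setoid G) e).comap θ = ⊤ :=
    eq_top_iff.mpr fun z _ => ⟨mem_constOn_bot, hθe z⟩
  have hfix (s : Setoid G) : ∀ z ∈ constOnFixed s e, e * z = z := fun z hz => hz.2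
  rw [hcomap _ (hfix _), hcomap _ (hfix _), ← finrank_top ℚ_[p] (Matrix (Fin m) (Fin m) D),
    ← htop, hcomap _ (hfix _)] at key
  exact key

end PadicCorner

/-! ### Freeness modulo p and divisibility of coefficients -/

section Freeness

variable {p : ℕ} [Fact p.Prime] {G : Type*} [Group G] [Finite G] {u : G} (hu : orderOf u = p)

-- The kernel of left multiplication by u, minus the identity, has dimension |G|/p, the number of
-- cosets of ⟨u⟩. This is equality in the kernel bound, so the kernel is the image of the norm.
include hu in
theorem exists_leftMulEnd_sub_one_pow {z : (ZMod p)[G]} (hz : MonoidAlgebra.single u 1 * z = z) :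
    ∃ y, ((leftMulEnd p u - 1) ^ (p - 1)) y = z := by
  have hpp : p - 1 + 1 = p := Nat.sub_add_cancel (Fact.out : p.Prime).one_le
  have hT := sub_one_pow_char_eq_zero (leftMulEnd_pow_eq_one (p := p) (hu ▸ pow_orderOf_eq_one u))
  have hker : LinearMap.ker (leftMulEnd p u - 1) =
      constOn (ZMod p) (QuotientGroup.rightRel (Subgroup.zpowers u)) := by
    ext z
    rw [mem_constOn_rightRel_iff, LinearMap.mem_ker, LinearMap.sub_apply, leftMulEnd_apply,
      Module.End.one_apply, sub_eq_zero]
  have hcard : finrank (ZMod p) (ZMod p)[G] =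
      (p - 1 + 1) * finrank (ZMod p) (LinearMap.ker (leftMulEnd p u - 1)) := by
    have := Fintype.ofFinite G
    rw [hker, finrank_constOn, hpp, Module.finrank_eq_card_basis (MonoidAlgebra.basis G (ZMod p)),
      Nat.card_congr (QuotientGroup.quotientRightRelEquivQuotientLeftRel _), ← hu,
      ← Nat.card_zpowers, ← Nat.card_eq_fintype_card]
    exact (Subgroup.card_mul_index _).symm
  exact ker_le_range_pow_of_finrank_eq hT hcard (hker ▸ mem_constOn_rightRel_iff.mpr hz)

-- Let d, a, s be the dimensions of the block and of its left-fixed and bi-fixed parts, and K its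
-- part fixed by conjugation. Freeness on the left gives d = pa, and a² = sd then gives d = p²s when
-- d ≠ 0. Nilpotency gives d ≤ p dim K and dim K ≤ ps, so d = p dim K. Equality puts the
-- conjugation-fixed element e in the image of the conjugation norm.
include hu in
theorem exists_eq_sum_conj {e : (ZMod p)[G]} (idem : IsIdempotentElem e)
    (central : ∀ a, e * a = a * e)
    (hdim : finrank (ZMod p) (constOnFixed (QuotientGroup.rightRel (Subgroup.zpowers u)) e) ^ 2 =
      finrank (ZMod p) (constOnFixed
        (DoubleCoset.setoid (Subgroup.zpowers u : Set G) (Subgroup.zpowers u)) e) *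
      finrank (ZMod p) (constOnFixed (⊥ : Setoid G) e)) :
    ∃ y : (ZMod p)[G], e = ∑ i ∈ Finset.range p,
      MonoidAlgebra.single (u ^ i) 1 * y * MonoidAlgebra.single (u ^ i)⁻¹ 1 := by
  have hpp : p - 1 + 1 = p := Nat.sub_add_cancel (Fact.out : p.Prime).one_le
  have hup : u ^ p = 1 := hu ▸ pow_orderOf_eq_one u
  have hT := sub_one_pow_char_eq_zero (leftMulEnd_pow_eq_one (p := p) hup)
  have hC := sub_one_pow_char_eq_zero (conjEnd_pow_eq_one (p := p) hup)
  have hTk (z) : (leftMulEnd p u - 1) z = 0 ↔ MonoidAlgebra.single u 1 * z = z := by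
    rw [LinearMap.sub_apply, leftMulEnd_apply, Module.End.one_apply, sub_eq_zero]
  have hCk (z) : (conjEnd p u - 1) z = 0 ↔ MonoidAlgebra.single u 1 * z =
      z * MonoidAlgebra.single u 1 := by
    rw [LinearMap.sub_apply, conjEnd_apply, Module.End.one_apply, sub_eq_zero]
    constructor
    · intro h
      conv_rhs => rw [← h]
      rw [mul_assoc _ _ (MonoidAlgebra.single u 1), MonoidAlgebra.single_mul_single,
        inv_mul_cancel, mul_one, ← MonoidAlgebra.one_def, mul_one]
    · intro h
      rw [h, mul_assoc, MonoidAlgebra.single_mul_single, mul_inv_cancel, mul_one,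
        ← MonoidAlgebra.one_def, mul_one]
  set M : Submodule (ZMod p) (ZMod p)[G] := constOnFixed (⊥ : Setoid G) e with hMdef
  have hM (z) : z ∈ M ↔ e * z = z := ⟨fun h => h.2, fun h => ⟨mem_constOn_bot, h⟩⟩
  have hMT : ∀ z ∈ M, (leftMulEnd p u - 1) z ∈ M := fun z hz => by
    rw [hM] at hz ⊢
    rw [LinearMap.sub_apply, leftMulEnd_apply, Module.End.one_apply, mul_sub, hz, ← mul_assoc,
      central, mul_assoc, hz]
  have hMC : ∀ z ∈ M, (conjEnd p u - 1) z ∈ M := fun z hz => by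
    rw [hM] at hz ⊢
    rw [LinearMap.sub_apply, conjEnd_apply, Module.End.one_apply, mul_sub, hz, ← mul_assoc,
      ← mul_assoc, central, mul_assoc _ e, hz]
  have h1 : finrank (ZMod p) M = (p - 1 + 1) *
      finrank (ZMod p) (constOnFixed (QuotientGroup.rightRel (Subgroup.zpowers u)) e) := by
    have hinf : M ⊓ LinearMap.ker (leftMulEnd p u - 1) =
        constOnFixed (QuotientGroup.rightRel (Subgroup.zpowers u)) e := by
      ext z
      rw [Submodule.mem_inf, hM, LinearMap.mem_ker, hTk, ← mem_constOn_rightRel_iff, and_comm]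
      rfl
    rw [finrank_submodule_eq_mul hMT hT, hinf]
    · intro z hz hz0
      obtain ⟨y, hy⟩ := exists_leftMulEnd_sub_one_pow hu ((hTk z).mp hz0)
      refine ⟨e * y, (hM _).mpr (by rw [← mul_assoc, idem.eq]), ?_⟩
      rw [sub_one_pow_pred_char, LinearMap.sum_apply] at hy ⊢
      rw [← (hM z).mp hz, ← hy, Finset.mul_sum]
      refine Finset.sum_congr rfl fun i _ => ?_
      rw [leftMulEnd_pow_apply, leftMulEnd_pow_apply, ← mul_assoc, ← mul_assoc, central]
  have h2 := finrank_submodule_le_mul hMC hC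
  -- Left multiplication by u commutes with conjugation by u. On vectors fixed by conjugation,
  -- left-fixed and bi-fixed are the same condition.
  have hKT : ∀ z ∈ M ⊓ LinearMap.ker (conjEnd p u - 1),
      (leftMulEnd p u - 1) z ∈ M ⊓ LinearMap.ker (conjEnd p u - 1) := fun z hz => by
    refine ⟨hMT z hz.1, ?_⟩
    have hz2 := (hCk z).mp hz.2
    change (leftMulEnd p u - 1) z ∈ LinearMap.ker (conjEnd p u - 1)
    rw [LinearMap.mem_ker, hCk, LinearMap.sub_apply, leftMulEnd_apply, Module.End.one_apply,
      mul_sub, sub_mul, hz2, ← mul_assoc, hz2]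
  have h3 := finrank_submodule_le_mul hKT hT
  have h4 : M ⊓ LinearMap.ker (conjEnd p u - 1) ⊓ LinearMap.ker (leftMulEnd p u - 1) =
      constOnFixed (DoubleCoset.setoid (Subgroup.zpowers u : Set G) (Subgroup.zpowers u)) e := by
    ext z
    rw [Submodule.mem_inf, Submodule.mem_inf, hM, LinearMap.mem_ker, hCk, LinearMap.mem_ker, hTk]
    change _ ↔ z ∈ constOn (ZMod p) _ ∧ e * z = z
    rw [mem_constOn_doubleCoset_iff]
    constructor
    · rintro ⟨⟨h, h'⟩, h''⟩
      exact ⟨⟨h'', by rw [← h', h'']⟩, h⟩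
    · rintro ⟨⟨h, h'⟩, h''⟩
      exact ⟨⟨h'', by rw [h, h']⟩, h⟩
  rw [h4] at h3
  have h5 : finrank (ZMod p) M = (p - 1 + 1) *
      finrank (ZMod p) (M ⊓ LinearMap.ker (conjEnd p u - 1) : Submodule _ _) := by
    refine le_antisymm h2 ?_
    set d := finrank (ZMod p) M
    set a := finrank (ZMod p) (constOnFixed (QuotientGroup.rightRel (Subgroup.zpowers u)) e)
    set s := finrank (ZMod p) (constOnFixed
      (DoubleCoset.setoid (Subgroup.zpowers u : Set G) (Subgroup.zpowers u)) e)
    rw [hpp] at h1 h3 ⊢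
    -- Cancel d from p²sd = (pa)² = d²; d = 0 is treated separately because it cannot be cancelled.
    have hd : p * (p * s) ≤ d := by
      rcases Nat.eq_zero_or_pos d with h0 | h0
      · have : s ≤ d := Submodule.finrank_mono fun z hz => ⟨mem_constOn_bot, hz.2⟩
        have : s = 0 := by omega
        simp [this]
      · apply le_of_eq
        apply Nat.eq_of_mul_eq_mul_right h0
        calc p * (p * s) * d = p * p * (s * d) := by ring
          _ = (p * a) * (p * a) := by rw [← hdim]; ring
          _ = d * d := by rw [← h1]
    exact (Nat.mul_le_mul_left p h3).trans hd
  have he : e ∈ M := (hM e).mpr idem.eq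
  obtain ⟨y, -, hy⟩ := exists_pow_apply_eq_of_finrank_submodule_eq hMC hC h5 he
    ((hCk e).mpr (central _).symm)
  refine ⟨y, ?_⟩
  rw [← hy, sub_one_pow_pred_char, LinearMap.sum_apply]
  exact Finset.sum_congr rfl fun i _ => conjEnd_pow_apply i y

end Freeness

section CoefficientsOfIntegralIdempotents

variable {p : ℕ} [Fact p.Prime] {G : Type*} [Group G] [Finite G]
  {m : ℕ} {D : Type*} [DivisionRing D] [Algebra ℚ_[p] D]

/-- If `ℚ_p[G] e` is simple for a central idempotent `e` of `ℤ_p[G]`, the coefficients of `e` at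
elements centralised by an element of order `p` are divisible by `p`. -/
theorem dvd_coeff_of_commute {e : ℤ_[p][G]} (idem : IsIdempotentElem (includeCoeff p G e))
    (central : ∀ a, includeCoeff p G e * a = a * includeCoeff p G e)
    (φ : idem.Corner ≃ₐ[ℚ_[p]] Matrix (Fin m) (Fin m) D)
    {u : G} (hu : orderOf u = p) {g : G} (hg : Commute u g) :
    (p : ℤ_[p]) ∣ e.coeff g := by
  have idem' : IsIdempotentElem e := by
    apply includeCoeff_injective
    rw [map_mul, idem.eq]
  have central' (a) : e * a = a * e := by
    apply includeCoeff_injective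
    rw [map_mul, map_mul, central]
  have centralF (a) : reduceCoeff p G e * a = a * reduceCoeff p G e := by
    have hs : Function.Surjective (reduceCoeff p G) := by
      rw [MonoidAlgebra.coe_mapRingHom]
      intro z
      obtain ⟨t, ht⟩ := (ZMod.ringHom_surjective (PadicInt.toZMod (p := p))).hasRightInverse
      refine ⟨MonoidAlgebra.ofCoeff (Finsupp.equivFunOnFinite.symm fun g => t (z.coeff g)), ?_⟩
      ext g
      simp [ht _]
    obtain ⟨b, rfl⟩ := hs a
    rw [← map_mul, ← map_mul, central']
  have stable {k : Type _} [Field k] {f : k[G]} (hf : ∀ a, f * a = a * f) :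
      (∀ z ∈ constOn k (QuotientGroup.rightRel (Subgroup.zpowers u)), f * z ∈
        constOn k (QuotientGroup.rightRel (Subgroup.zpowers u))) ∧
      (∀ z ∈ constOn k (DoubleCoset.setoid (Subgroup.zpowers u : Set G) (Subgroup.zpowers u)),
        f * z ∈ constOn k
          (DoubleCoset.setoid (Subgroup.zpowers u : Set G) (Subgroup.zpowers u))) := by
    constructor
    · intro z hz
      rw [mem_constOn_rightRel_iff] at hz ⊢
      rw [← mul_assoc, ← hf, mul_assoc, hz]
    · intro z hz
      rw [mem_constOn_doubleCoset_iff] at hz ⊢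
      exact ⟨by rw [← mul_assoc, ← hf, mul_assoc, hz.1], by rw [mul_assoc, hz.2]⟩
  have hdim := finrank_constOnFixed_sq idem φ central hu
  rw [← finrank_constOnFixed_reduce_eq idem' (stable central).1 (stable centralF).1,
    ← finrank_constOnFixed_reduce_eq idem' (stable central).2 (stable centralF).2,
    ← finrank_constOnFixed_reduce_eq idem' (fun _ _ => mem_constOn_bot)
      (fun _ _ => mem_constOn_bot)] at hdim
  obtain ⟨y, hy⟩ := exists_eq_sum_conj hu (idem'.map (reduceCoeff p G)) centralF hdim
  -- At a g commuting with u all p conjugates of y have the same coefficient, so the norm has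
  -- coefficient p · y(g) = 0 there.
  have hterm (i : ℕ) : (MonoidAlgebra.single (u ^ i) 1 * y *
      MonoidAlgebra.single (u ^ i)⁻¹ 1).coeff g = y.coeff g := by
    have hi : (u ^ i)⁻¹ * (g * u ^ i) = g := by
      rw [← (hg.pow_left i).eq, inv_mul_cancel_left]
    rw [MonoidAlgebra.coeff_mul_single_apply, MonoidAlgebra.coeff_single_mul_apply, inv_inv, hi,
      one_mul, mul_one]
  rw [← PadicInt.toZMod_eq_zero_iff, ← MonoidAlgebra.coeff_mapRingHom, hy,
    MonoidAlgebra.coeff_sum, Finset.sum_apply', Finset.sum_congr rfl fun i _ => hterm i,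
    Finset.sum_const, Finset.card_range, nsmul_eq_mul, CharP.cast_eq_zero, zero_mul]

end CoefficientsOfIntegralIdempotents

/-! ### Irreducible representations: transport, separation of elements, Galois twists -/

section IrreducibleTransport

open Representation

variable {G k V W : Type*} [Group G] [Field k] [AddCommGroup V] [Module k V] [AddCommGroup W]
  [Module k W]

/-- Semilinearity lets the same argument serve for a change of basis and for a twist by a field
automorphism. -/
theorem isIrreducible_of_semilinearEquiv {σ σ' : k →+* k} [RingHomInvPair σ σ']
    [RingHomInvPair σ' σ] (s : V ≃ₛₗ[σ] W) {ρ : Representation k G V} {τ : Representation k G W}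
    (h : ∀ g v, s (ρ g v) = τ g (s v)) (hρ : ρ.IsIrreducible) : τ.IsIrreducible := by
  let f : Subrepresentation τ ≃o Subrepresentation ρ :=
    { toFun := fun U => ⟨U.toSubmodule.comap s.toLinearMap, fun g v hv => by
        change s (ρ g v) ∈ U.toSubmodule
        rw [h]
        exact U.apply_mem_toSubmodule g hv⟩
      invFun := fun U => ⟨U.toSubmodule.comap s.symm.toLinearMap, fun g v hv => by
        change s.symm (τ g v) ∈ U.toSubmodule
        have : s.symm (τ g v) = ρ g (s.symm v) := by
          rw [LinearEquiv.symm_apply_eq, h, LinearEquiv.apply_symm_apply]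
        rw [this]
        exact U.apply_mem_toSubmodule g hv⟩
      left_inv := fun U => Subrepresentation.ext (Submodule.ext fun v => by
        change s (s.symm v) ∈ U.toSubmodule ↔ _
        rw [LinearEquiv.apply_symm_apply])
      right_inv := fun U => Subrepresentation.ext (Submodule.ext fun v => by
        change s.symm (s v) ∈ U.toSubmodule ↔ _
        rw [LinearEquiv.symm_apply_apply])
      map_rel_iff' := fun {U U'} => by
        constructor
        · intro hle v hv
          have : s.symm v ∈ U.toSubmodule.comap s.toLinearMap := by
            change s (s.symm v) ∈ U.toSubmodule
            rwa [LinearEquiv.apply_symm_apply]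
          have h2 : s (s.symm v) ∈ U'.toSubmodule := hle this
          rwa [LinearEquiv.apply_symm_apply] at h2
        · intro hle v hv
          exact hle hv }
  exact f.isSimpleOrder_iff.mpr hρ

theorem asAlgebraHom_ofModule' (M : Type*) [AddCommGroup M] [Module k M] [Module k[G] M]
    [IsScalarTower k k[G] M] (z : k[G]) (x : M) :
    (ofModule' (k := k) (G := G) M).asAlgebraHom z x = z • x := by
  have : (ofModule' (k := k) (G := G) M).asAlgebraHom = Algebra.lsmul k k M :=
    MonoidAlgebra.algHom_ext (fun g => by
      rw [asAlgebraHom_single_one]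
      rfl) (Subsingleton.elim _ _)
  rw [this]
  rfl

theorem isIrreducible_ofModule' (M : Type*) [AddCommGroup M] [Module k M] [Module k[G] M]
    [IsScalarTower k k[G] M] (hM : IsSimpleModule k[G] M) :
    (ofModule' (k := k) (G := G) M).IsIrreducible := by
  let f : Subrepresentation (ofModule' (k := k) (G := G) M) ≃o Submodule k[G] M :=
    { toFun := fun U =>
        { U.toSubmodule with
          smul_mem' := fun z x hx => by
            change z • x ∈ U.toSubmodule
            induction z using MonoidAlgebra.induction_linear with
            | zero => rw [zero_smul]; exact zero_mem _
            | add y z hy hz => rw [add_smul]; exact add_mem hy hz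
            | single g a =>
              rw [← asAlgebraHom_ofModule', asAlgebraHom_single]
              exact U.toSubmodule.smul_mem _ (U.apply_mem_toSubmodule g hx) }
      invFun := fun U => ⟨U.restrictScalars k, fun g v hv => by
        rw [← asAlgebraHom_single_one, asAlgebraHom_ofModule']
        exact U.smul_mem _ hv⟩
      left_inv := fun U => rfl
      right_inv := fun U => rfl
      map_rel_iff' := Iff.rfl }
  exact f.isSimpleOrder_iff.mpr ((isSimpleModule_iff _ _).mp hM)

theorem smul_eq_zero_of_forall_isIrreducible {z : k[G]}
    (hz : ∀ (n : ℕ) (ρ : Representation k G (Fin n → k)), ρ.IsIrreducible → ρ.asAlgebraHom z = 0)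
    (M : Type*) [AddCommGroup M] [Module k M] [Module k[G] M] [IsScalarTower k k[G] M]
    [Module.Finite k M] (hM : IsSimpleModule k[G] M) (x : M) : z • x = 0 := by
  let ρ := ofModule' (k := k) (G := G) M
  have hρ : ρ.IsIrreducible := isIrreducible_ofModule' M hM
  let b := (Module.finBasis k M).equivFun
  let τ : Representation k G (Fin _ → k) := (b.conjAlgEquiv k).toAlgHom.toMonoidHom.comp ρ
  have hτ : τ.IsIrreducible := by
    refine isIrreducible_of_semilinearEquiv b (fun g v => ?_) hρ
    change b (ρ g v) = b (ρ g (b.symm (b v)))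
    rw [LinearEquiv.symm_apply_apply]
  have hτz : τ.asAlgebraHom = (b.conjAlgEquiv k).toAlgHom.comp ρ.asAlgebraHom :=
    MonoidAlgebra.algHom_ext (fun g => by
      rw [asAlgebraHom_single_one, AlgHom.comp_apply, asAlgebraHom_single_one]
      rfl) (Subsingleton.elim _ _)
  have h0 := hz _ τ hτ
  rw [hτz] at h0
  have h1 : ρ.asAlgebraHom z = 0 := (b.conjAlgEquiv k).injective (h0.trans (map_zero _).symm)
  rw [← asAlgebraHom_ofModule', h1, LinearMap.zero_apply]

/-- By Maschke, k[G] is the sum of its simple left ideals. An element acting as zero on all of them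
kills 1. -/
theorem exists_isIrreducible_asAlgebraHom_ne_zero [Finite G] [NeZero (Nat.card G : k)] {z : k[G]}
    (hz : z ≠ 0) : ∃ (n : ℕ) (ρ : Representation k G (Fin n → k)),
      ρ.IsIrreducible ∧ ρ.asAlgebraHom z ≠ 0 := by
  by_contra! hcon
  apply hz
  have h1 : (1 : k[G]) ∈ ⨆ S : {m : Submodule k[G] k[G] | IsSimpleModule k[G] m}, S.1 := by
    rw [← sSup_eq_iSup', IsSemisimpleModule.sSup_simples_eq_top k[G] k[G]]
    trivial
  have h2 : z * 1 = 0 := by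
    refine Submodule.iSup_induction _ (motive := fun x => z * x = 0) h1 (fun S x hx => ?_)
      (mul_zero z) fun x y hx hy => by rw [mul_add, hx, hy, add_zero]
    have : Module.Finite k S.1 :=
      Module.Finite.of_injective (S.1.subtype.restrictScalars k) S.1.injective_subtype
    exact congrArg Subtype.val (smul_eq_zero_of_forall_isIrreducible hcon S.1 S.2 ⟨x, hx⟩)
  rwa [mul_one] at h2

/-- The conjugate of a representation by a ring automorphism of the field of coefficients. -/
def Representation.twist {n : ℕ} (σ : k ≃+* k) (ρ : Representation k G (Fin n → k)) :
    Representation k G (Fin n → k) where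
  toFun g :=
    { toFun := fun v i => σ (ρ g (fun j => σ.symm (v j)) i)
      map_add' := fun v w => by
        ext i
        have : (fun j => σ.symm ((v + w) j)) = (fun j => σ.symm (v j)) + fun j => σ.symm (w j) := by
          ext j; simp
        rw [this, map_add]; simp
      map_smul' := fun c v => by
        ext i
        have : (fun j => σ.symm ((c • v) j)) = σ.symm c • fun j => σ.symm (v j) := by
          ext j; simp
        rw [this, map_smul]; simp }
  map_one' := by ext; simp
  map_mul' g h := by ext; simp

theorem Representation.twist_apply {n : ℕ} (σ : k ≃+* k) (ρ : Representation k G (Fin n → k))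
    (g : G) (v : Fin n → k) (i : Fin n) :
    ρ.twist σ g v i = σ (ρ g (fun j => σ.symm (v j)) i) := rfl

theorem Representation.character_twist {n : ℕ} (σ : k ≃+* k) (ρ : Representation k G (Fin n → k))
    (g : G) : (ρ.twist σ).character g = σ (ρ.character g) := by
  classical
  rw [character, character, LinearMap.trace_eq_matrix_trace k (Pi.basisFun k (Fin n)),
    LinearMap.trace_eq_matrix_trace k (Pi.basisFun k (Fin n)), Matrix.trace, Matrix.trace, map_sum]
  refine Finset.sum_congr rfl fun i _ => ?_
  rw [Matrix.diag_apply, Matrix.diag_apply, LinearMap.toMatrix_apply, LinearMap.toMatrix_apply]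
  simp only [Pi.basisFun_apply, Pi.basisFun_repr, twist_apply]
  have : (fun j => σ.symm ((Pi.single i 1 : Fin n → k) j)) = Pi.single i 1 := by
    funext j
    by_cases h : j = i
    · subst h; simp
    · simp [h]
  rw [this]

theorem Representation.IsIrreducible.twist {n : ℕ} (σ : k ≃+* k)
    {ρ : Representation k G (Fin n → k)} (hρ : ρ.IsIrreducible) : (ρ.twist σ).IsIrreducible := by
  have : RingHomInvPair (σ : k →+* k) (σ.symm : k →+* k) := RingHomInvPair.of_ringEquiv σ
  have : RingHomInvPair (σ.symm : k →+* k) (σ : k →+* k) := RingHomInvPair.of_ringEquiv σ.symm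
  let s : (Fin n → k) ≃ₛₗ[(σ : k →+* k)] (Fin n → k) :=
    { toFun := fun v i => σ (v i)
      invFun := fun v i => σ.symm (v i)
      map_add' := fun v w => by ext; simp
      map_smul' := fun c v => by ext; simp
      left_inv := fun v => by ext; simp
      right_inv := fun v => by ext; simp }
  refine isIrreducible_of_semilinearEquiv s (fun g v => ?_) hρ
  ext i
  change σ (ρ g v i) = σ (ρ g (fun j => σ.symm (σ (v j))) i)
  simp

end IrreducibleTransport

/-! ### Automorphisms of ℂ_p over ℚ_p -/

section GaloisAction

variable {p : ℕ} [Fact p.Prime]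

/-- The norm is the spectral norm, so τ and its inverse are isometries and extend to the completion
by continuity. -/
theorem exists_algEquiv_padicComplex_extending (τ : PadicAlgCl p ≃ₐ[ℚ_[p]] PadicAlgCl p) :
    ∃ σ : ℂ_[p] ≃ₐ[ℚ_[p]] ℂ_[p], ∀ x : PadicAlgCl p, σ (x : ℂ_[p]) = (τ x : ℂ_[p]) := by
  have hiso (τ : PadicAlgCl p ≃ₐ[ℚ_[p]] PadicAlgCl p) : Isometry τ :=
    AddMonoidHomClass.isometry_of_norm τ fun x => by
      rw [← PadicAlgCl.spectralNorm_eq, ← PadicAlgCl.spectralNorm_eq]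
      exact (spectralNorm_eq_of_equiv τ x).symm
  let f (τ : PadicAlgCl p ≃ₐ[ℚ_[p]] PadicAlgCl p) : ℂ_[p] →+* ℂ_[p] :=
    UniformSpace.Completion.mapRingHom (τ : PadicAlgCl p →+* PadicAlgCl p) (hiso τ).continuous
  have hf (τ : PadicAlgCl p ≃ₐ[ℚ_[p]] PadicAlgCl p) (x : PadicAlgCl p) :
      f τ (x : ℂ_[p]) = (τ x : ℂ_[p]) :=
    UniformSpace.Completion.mapRingHom_coe (hiso τ).continuous x
  have hinv (τ : PadicAlgCl p ≃ₐ[ℚ_[p]] PadicAlgCl p) (x : ℂ_[p]) : f τ (f τ.symm x) = x := by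
    induction x using UniformSpace.Completion.induction_on with
    | hp =>
      refine isClosed_eq ?_ continuous_id
      exact UniformSpace.Completion.continuous_map.comp UniformSpace.Completion.continuous_map
    | ih x => rw [hf, hf, AlgEquiv.apply_symm_apply]
  refine ⟨AlgEquiv.ofRingEquiv (f := { f τ with
      invFun := f τ.symm
      left_inv := hinv τ.symm
      right_inv := hinv τ }) fun r => ?_, hf τ⟩
  change f τ ((algebraMap ℚ_[p] (PadicAlgCl p) r : PadicAlgCl p) : ℂ_[p]) = _
  rw [hf, AlgEquiv.commutes]
  rfl

/-- An algebraic element already lies in the algebraic closure of ℚ_p, where Galois theory applies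
because every automorphism there extends to ℂ_p. -/
theorem mem_range_algebraMap_of_forall_algEquiv {z : ℂ_[p]} (hz : IsAlgebraic ℚ_[p] z)
    (hfix : ∀ σ : ℂ_[p] ≃ₐ[ℚ_[p]] ℂ_[p], σ z = z) : ∃ q : ℚ_[p], algebraMap ℚ_[p] ℂ_[p] q = z := by
  obtain ⟨y, rfl⟩ : ∃ y : PadicAlgCl p, (y : ℂ_[p]) = z := by
    have h0 := minpoly.ne_zero hz.isIntegral
    refine Polynomial.Splits.mem_range_of_isRoot (i := algebraMap (PadicAlgCl p) ℂ_[p])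
      (IsAlgClosed.splits ((minpoly ℚ_[p] z).map (algebraMap ℚ_[p] (PadicAlgCl p))))
      (Polynomial.map_ne_zero h0) ?_
    rw [Polynomial.map_map, ← IsScalarTower.algebraMap_eq, Polynomial.IsRoot.def,
      Polynomial.eval_map_algebraMap, minpoly.aeval]
  obtain ⟨q, hq⟩ := (InfiniteGalois.mem_range_algebraMap_iff_fixed (k := ℚ_[p]) y).mpr fun τ => by
    obtain ⟨σ, hσ⟩ := exists_algEquiv_padicComplex_extending τ
    have := hfix σ
    rw [hσ] at this
    exact UniformSpace.Completion.coe_injective _ this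
  exact ⟨q, by rw [← hq]; rfl⟩

end GaloisAction

/-! ### Norms of eigenvalues and traces -/

section EigenvalueNorms

theorem norm_le_one_of_monic_root {K : Type*} [NormedField K] [IsUltrametricDist K]
    {P : Polynomial K} (hP : P.Monic) (hc : ∀ i, ‖P.coeff i‖ ≤ 1) {μ : K} (hμ : P.eval μ = 0) :
    ‖μ‖ ≤ 1 := by
  by_contra! hlt
  rcases Nat.eq_zero_or_pos P.natDegree with h0 | h0
  · rw [Polynomial.Monic.natDegree_eq_zero hP] at h0
    simp [h0] at hμ
  · rw [Polynomial.eval_eq_sum_range, Finset.sum_range_succ, Polynomial.Monic.coeff_natDegree hP,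
      one_mul, add_eq_zero_iff_eq_neg'] at hμ
    have h1 : ‖∑ i ∈ Finset.range P.natDegree, P.coeff i * μ ^ i‖ ≤ ‖μ‖ ^ (P.natDegree - 1) := by
      refine IsUltrametricDist.norm_sum_le_of_forall_le_of_nonneg (by positivity) fun i hi => ?_
      rw [norm_mul, norm_pow]
      have hi' : i ≤ P.natDegree - 1 := by
        have := Finset.mem_range.mp hi
        omega
      calc ‖P.coeff i‖ * ‖μ‖ ^ i ≤ 1 * ‖μ‖ ^ i := by gcongr; exact hc i
        _ ≤ ‖μ‖ ^ (P.natDegree - 1) := by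
          rw [one_mul]; exact pow_le_pow_right₀ hlt.le hi'
    have h2 : ‖μ‖ ^ P.natDegree ≤ ‖μ‖ ^ (P.natDegree - 1) := by
      rw [← norm_pow, hμ, norm_neg]
      exact h1
    have h3 : ‖μ‖ ^ (P.natDegree - 1) < ‖μ‖ ^ P.natDegree := pow_lt_pow_right₀ hlt (by omega)
    exact absurd h2 (not_le.mpr h3)

/-- The trace is the sum of the eigenvalues with multiplicity. It is used with the closed and open
unit balls and with the algebraic elements. -/
theorem trace_mem_of_forall_hasEigenvalue {K V : Type*} [Field K] [IsAlgClosed K] [AddCommGroup V]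
    [Module K V] [FiniteDimensional K V] {f : End K V} (S : AddSubmonoid K)
    (h : ∀ μ, f.HasEigenvalue μ → μ ∈ S) : LinearMap.trace K V f ∈ S := by
  rw [Module.End.trace_eq_sum_roots_charpoly_of_splits (IsAlgClosed.splits _)]
  refine AddSubmonoid.multiset_sum_mem S _ fun μ hμ => h μ ?_
  rw [Module.End.hasEigenvalue_iff_isRoot_charpoly]
  exact Polynomial.isRoot_of_mem_roots hμ

end EigenvalueNorms

/-! ### Action of ℚ_p[G] on irreducible representations -/

section PadicAction

variable {p : ℕ} [Fact p.Prime] {G : Type*} [Group G] {n : ℕ}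

variable (p G) in
/-- The inclusion of `ℚ_p[G]` in `ℂ_p[G]`. -/
noncomputable abbrev complexify : ℚ_[p][G] →ₐ[ℚ_[p]] ℂ_[p][G] :=
  MonoidAlgebra.mapAlgHom G (Algebra.ofId ℚ_[p] ℂ_[p])

variable (ρ : Representation ℂ_[p] G (Fin n → ℂ_[p]))

/-- The action of `ℚ_p[G]` on the space of a representation over `ℂ_p`. -/
noncomputable def padicAction : ℚ_[p][G] →+* End ℂ_[p] (Fin n → ℂ_[p]) :=
  ρ.asAlgebraHom.toRingHom.comp (complexify p G).toRingHom

theorem padicAction_apply (x : ℚ_[p][G]) :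
    padicAction ρ x = ρ.asAlgebraHom (complexify p G x) := rfl

theorem padicAction_single (g : G) (a : ℚ_[p]) :
    padicAction ρ (MonoidAlgebra.single g a) = algebraMap ℚ_[p] ℂ_[p] a • ρ g := by
  rw [padicAction_apply, MonoidAlgebra.mapAlgHom_single, Representation.asAlgebraHom_single]
  rfl

theorem padicAction_algebraMap (a : ℚ_[p]) :
    padicAction ρ (algebraMap _ _ a) = algebraMap ℂ_[p] _ (algebraMap ℚ_[p] ℂ_[p] a) := by
  rw [MonoidAlgebra.coe_algebraMap, Function.comp_apply, padicAction_single, map_one,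
    Algebra.algebraMap_self_apply]
  exact (Algebra.algebraMap_eq_smul_one _).symm

theorem padicAction_smul (a : ℚ_[p]) (x : ℚ_[p][G]) :
    padicAction ρ (a • x) = algebraMap ℚ_[p] ℂ_[p] a • padicAction ρ x := by
  rw [Algebra.smul_def, map_mul, padicAction_algebraMap, ← Algebra.smul_def]

variable {ρ}

theorem norm_eigenvalue_le_one {x : ℚ_[p][G]} (hx : IsIntegral ℤ_[p] x) {μ : ℂ_[p]}
    (hμ : (padicAction ρ x).HasEigenvalue μ) : ‖μ‖ ≤ 1 := by
  obtain ⟨P, hP, hPx⟩ := hx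
  let Q := (P.map (algebraMap ℤ_[p] ℚ_[p])).map (algebraMap ℚ_[p] ℂ_[p])
  have hQ : Polynomial.aeval (padicAction ρ x) Q = 0 := by
    have h1 : (P.map (algebraMap ℤ_[p] ℚ_[p])).eval₂ (algebraMap ℚ_[p] ℚ_[p][G]) x = 0 := by
      rw [Polynomial.eval₂_map, ← hPx]
      rfl
    have h2 := congrArg (padicAction ρ) h1
    rw [map_zero, Polynomial.hom_eval₂] at h2
    rw [Polynomial.aeval_def, Polynomial.eval₂_map, ← h2]
    congr 1
    ext a
    rw [RingHom.comp_apply, RingHom.comp_apply, padicAction_algebraMap]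
  obtain ⟨v, hv⟩ := hμ.exists_hasEigenvector
  have h3 := Module.End.aeval_apply_of_hasEigenvector (p := Q) hv
  rw [hQ, LinearMap.zero_apply, eq_comm, smul_eq_zero, or_iff_left hv.2] at h3
  refine norm_le_one_of_monic_root ((hP.map _).map _) (fun i => ?_) h3
  rw [Polynomial.coeff_map, Polynomial.coeff_map, norm_algebraMap', PadicInt.algebraMap_apply]
  exact PadicInt.norm_le_one _

/-- An eigenvector of x for μ is one of y for μ^k/p, which has norm at most 1; so |μ|^k ≤ |p| < 1.
-/
theorem norm_eigenvalue_lt_one {x y : ℚ_[p][G]} (hy : IsIntegral ℤ_[p] y) {k : ℕ}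
    (hxy : x ^ k = (p : ℚ_[p]) • y) {μ : ℂ_[p]}
    (hμ : (padicAction ρ x).HasEigenvalue μ) : ‖μ‖ < 1 := by
  obtain ⟨v, hv⟩ := hμ.exists_hasEigenvector
  have hp0 : (p : ℂ_[p]) ≠ 0 := by exact_mod_cast (Fact.out : p.Prime).ne_zero
  have h1 := hv.pow_apply k
  rw [← map_pow, hxy, padicAction_smul, map_natCast, LinearMap.smul_apply] at h1
  have h2 : (padicAction ρ y).HasEigenvalue ((p : ℂ_[p])⁻¹ * μ ^ k) :=
    Module.End.hasEigenvalue_of_hasEigenvector (x := v) <| Module.End.hasEigenvector_iff.mpr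
      ⟨Module.End.mem_eigenspace_iff.mpr (by rw [mul_smul, ← h1, inv_smul_smul₀ hp0]), hv.2⟩
  have h3 := norm_eigenvalue_le_one hy h2
  have hpn : ‖(p : ℂ_[p])‖ < 1 := by
    rw [← map_natCast (algebraMap ℚ_[p] ℂ_[p]), norm_algebraMap']
    exact Padic.norm_p_lt_one
  rw [norm_mul, norm_inv, norm_pow, inv_mul_le_one₀ (norm_pos_iff.mpr hp0)] at h3
  by_contra! hge
  exact absurd (h3.trans_lt hpn) (not_lt.mpr (one_le_pow₀ hge))

theorem comp_mem_irrCharacters {χ : G → ℂ_[p]} (hχ : χ ∈ irrCharacters p G)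
    (σ : ℂ_[p] ≃ₐ[ℚ_[p]] ℂ_[p]) : (fun g => σ (χ g)) ∈ irrCharacters p G := by
  obtain ⟨n, ρ, hρ, rfl⟩ := hχ
  refine ⟨n, ρ.twist σ.toRingEquiv, hρ.twist _, ?_⟩
  funext g
  exact Representation.character_twist _ ρ g

theorem mem_irrCharacters_of_mem_galoisClass {χ ψ : G → ℂ_[p]} (hχ : χ ∈ irrCharacters p G)
    (hψ : ψ ∈ galoisClass p χ) : ψ ∈ irrCharacters p G := by
  obtain ⟨σ, rfl⟩ := hψ
  exact comp_mem_irrCharacters hχ σ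

theorem exists_asAlgebraHom_eq_smul {k : Type*} [Field k] [IsAlgClosed k]
    {ρ : Representation k G (Fin n → k)} (hρ : ρ.IsIrreducible) {z : k[G]}
    (hz : ∀ a, z * a = a * z) : ∃ ω : k, ρ.asAlgebraHom z = ω • 1 := by
  let f : Representation.IntertwiningMap ρ ρ :=
    (ρ.asAlgebraHom z).intertwiningMap_of_isIntertwiningMap ρ ρ fun g v => by
      rw [← Representation.asAlgebraHom_single_one, ← Module.End.mul_apply, ← map_mul, hz, map_mul,
        Module.End.mul_apply]
  obtain ⟨ω, hω⟩ :=
    (Representation.IsIrreducible.algebraMap_intertwiningMap_bijective_of_isAlgClosed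
      (ρ := ρ)).2 f
  refine ⟨ω, ?_⟩
  refine LinearMap.ext fun v => ?_
  exact (congrArg (fun F : Representation.IntertwiningMap ρ ρ => F v) hω).symm

theorem Representation.IsIrreducible.pos {k : Type*} [Field k]
    {ρ : Representation k G (Fin n → k)} (hρ : ρ.IsIrreducible) : 0 < n := by
  rcases Nat.eq_zero_or_pos n with rfl | h
  · exfalso
    obtain ⟨x, y, hxy⟩ := hρ.toNontrivial
    exact hxy (Subrepresentation.ext (Subsingleton.elim _ _))
  · exact h

variable [Fintype G]

/-- The `ℚ_p`-linear extension of a function on `G` to `ℚ_p[G]`. -/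
noncomputable def charEval (χ : G → ℂ_[p]) (x : ℚ_[p][G]) : ℂ_[p] :=
  ∑ g, algebraMap ℚ_[p] ℂ_[p] (x.coeff g) * χ g

omit [Group G] in
theorem MonoidAlgebra.eq_sum_single {k : Type*} [Semiring k] (x : k[G]) :
    x = ∑ g, MonoidAlgebra.single g (x.coeff g) := by
  ext h
  rw [MonoidAlgebra.coeff_sum, Finset.sum_apply', Finset.sum_eq_single h]
  · simp
  · intro b _ hb
    rw [MonoidAlgebra.coeff_single, Finsupp.single_eq_of_ne (Ne.symm hb)]
  · simp

theorem charEval_character (ρ : Representation ℂ_[p] G (Fin n → ℂ_[p])) (x : ℚ_[p][G]) :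
    charEval ρ.character x = LinearMap.trace _ _ (padicAction ρ x) := by
  conv_rhs => rw [MonoidAlgebra.eq_sum_single x, map_sum, map_sum]
  refine Finset.sum_congr rfl fun g _ => ?_
  rw [padicAction_single, map_smul, smul_eq_mul]
  rfl

omit [Group G] in
theorem charEval_comp_algEquiv (σ : ℂ_[p] ≃ₐ[ℚ_[p]] ℂ_[p]) (χ : G → ℂ_[p]) (x : ℚ_[p][G]) :
    charEval (fun g => σ (χ g)) x = σ (charEval χ x) := by
  rw [charEval, charEval, map_sum]
  exact Finset.sum_congr rfl fun g _ => by rw [map_mul, AlgEquiv.commutes]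

theorem norm_charEval_le_one {χ : G → ℂ_[p]} (hχ : χ ∈ irrCharacters p G) {x : ℚ_[p][G]}
    (hx : IsIntegral ℤ_[p] x) : ‖charEval χ x‖ ≤ 1 := by
  obtain ⟨n, ρ, -, rfl⟩ := hχ
  rw [charEval_character]
  let S : AddSubmonoid ℂ_[p] :=
    { carrier := {z | ‖z‖ ≤ 1}
      zero_mem' := by simp
      add_mem' := fun {a b} ha hb => (IsUltrametricDist.norm_add_le_max a b).trans (max_le ha hb) }
  exact trace_mem_of_forall_hasEigenvalue S fun μ hμ => norm_eigenvalue_le_one hx hμ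

theorem norm_charEval_lt_one {χ : G → ℂ_[p]} (hχ : χ ∈ irrCharacters p G) {x y : ℚ_[p][G]}
    (hy : IsIntegral ℤ_[p] y) {k : ℕ} (hxy : x ^ k = (p : ℚ_[p]) • y) : ‖charEval χ x‖ < 1 := by
  obtain ⟨n, ρ, -, rfl⟩ := hχ
  rw [charEval_character]
  let S : AddSubmonoid ℂ_[p] :=
    { carrier := {z | ‖z‖ < 1}
      zero_mem' := by simp
      add_mem' := fun {a b} ha hb => (IsUltrametricDist.norm_add_le_max a b).trans_lt
        (max_lt ha hb) }
  exact trace_mem_of_forall_hasEigenvalue S fun μ hμ => norm_eigenvalue_lt_one hy hxy hμ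

end PadicAction

/-! ### Galois classes of characters and the coefficient formula -/

section CharacterClass

variable {p : ℕ} [Fact p.Prime] {G : Type*} [Group G] [Fintype G]

theorem single_mem_integral (g : G) : IsIntegral ℤ_[p] (MonoidAlgebra.single g 1 : ℚ_[p][G]) := by
  refine IsIntegral.of_pow (n := Fintype.card G) Fintype.card_pos ?_
  rw [MonoidAlgebra.single_pow, pow_card_eq_one, one_pow, ← MonoidAlgebra.one_def]
  exact isIntegral_one

omit [Group G] in
theorem charEval_single (χ : G → ℂ_[p]) (g : G) :
    charEval χ (MonoidAlgebra.single g 1) = χ g := by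
  classical
  rw [charEval, Finset.sum_eq_single g]
  · simp
  · intro h _ hne
    rw [MonoidAlgebra.coeff_single, Finsupp.single_eq_of_ne hne, map_zero, zero_mul]
  · simp

theorem norm_character_le_one {χ : G → ℂ_[p]} (hχ : χ ∈ irrCharacters p G) (g : G) :
    ‖χ g‖ ≤ 1 := by
  rw [← charEval_single χ g]
  exact norm_charEval_le_one hχ (single_mem_integral g)

theorem isAlgebraic_character {χ : G → ℂ_[p]} (hχ : χ ∈ irrCharacters p G) (g : G) :
    IsAlgebraic ℚ_[p] (χ g) := by
  obtain ⟨n, ρ, -, rfl⟩ := hχ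
  let S : Subring ℂ_[p] := (integralClosure ℚ_[p] ℂ_[p]).toSubring
  suffices h : ρ.character g ∈ S.toAddSubmonoid from IsIntegral.isAlgebraic h
  refine trace_mem_of_forall_hasEigenvalue _ fun μ hμ => ?_
  obtain ⟨v, hv⟩ := hμ.exists_hasEigenvector
  have h1 := hv.pow_apply (Fintype.card G)
  rw [← map_pow, pow_card_eq_one, map_one, Module.End.one_apply] at h1
  have h2 : μ ^ Fintype.card G = 1 := by
    have h3 : (μ ^ Fintype.card G - 1) • v = 0 := by rw [sub_smul, ← h1, one_smul, sub_self]
    exact sub_eq_zero.mp ((smul_eq_zero.mp h3).resolve_right hv.2)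
  refine IsIntegral.of_pow (n := Fintype.card G) Fintype.card_pos ?_
  rw [h2]
  exact isIntegral_one

omit [Fintype G] in
theorem exists_degree {χ : G → ℂ_[p]} (hχ : χ ∈ irrCharacters p G) :
    ∃ d : ℕ, 0 < d ∧ χ 1 = d := by
  obtain ⟨n, ρ, hρ, rfl⟩ := hχ
  exact ⟨n, hρ.pos, by simp⟩

omit [Group G] [Fintype G] in
theorem self_mem_galoisClass (χ : G → ℂ_[p]) : χ ∈ galoisClass p χ :=
  ⟨AlgEquiv.refl, rfl⟩

/-- A conjugate of χ takes at each g a root of the minimal polynomial of χ(g), which leaves finitely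
many functions. Finiteness matters because `finsum` defaults to 0 on infinite support. -/
theorem finite_galoisClass {χ : G → ℂ_[p]} (hχ : χ ∈ irrCharacters p G) :
    (galoisClass p χ).Finite := by
  refine (Set.Finite.pi (t := fun g => ((minpoly ℚ_[p] (χ g)).rootSet ℂ_[p]))
    fun g => Polynomial.rootSet_finite _ _).subset ?_
  rintro _ ⟨σ, rfl⟩ g -
  rw [Polynomial.mem_rootSet]
  refine ⟨minpoly.ne_zero (isAlgebraic_character hχ g).isIntegral, ?_⟩
  change Polynomial.aeval (σ (χ g)) _ = 0
  rw [Polynomial.aeval_algHom_apply, minpoly.aeval, map_zero]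

omit [Fintype G] in
theorem apply_one_of_mem_galoisClass {χ ψ : G → ℂ_[p]} (hχ : χ ∈ irrCharacters p G)
    (hψ : ψ ∈ galoisClass p χ) : ψ 1 = χ 1 := by
  obtain ⟨σ, rfl⟩ := hψ
  obtain ⟨d, -, hd⟩ := exists_degree hχ
  change σ (χ 1) = χ 1
  rw [hd, map_natCast]

theorem coeff_charIdempotent (χ : G → ℂ_[p]) (g : G) :
    (charIdempotent p χ).coeff g = χ 1 * (Fintype.card G : ℂ_[p])⁻¹ * χ g⁻¹ := by
  classical
  rw [charIdempotent, MonoidAlgebra.coeff_sum, Finset.sum_apply', Finset.sum_eq_single g]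
  · simp
  · intro h _ hne
    rw [MonoidAlgebra.coeff_single, Finsupp.single_eq_of_ne (Ne.symm hne)]
  · simp

theorem coeff_finsum_charIdempotent {χ : G → ℂ_[p]} (hχ : χ ∈ irrCharacters p G) (g : G) :
    (∑ᶠ ψ ∈ galoisClass p χ, charIdempotent p ψ).coeff g =
      χ 1 * (Fintype.card G : ℂ_[p])⁻¹ * ∑ ψ ∈ (finite_galoisClass hχ).toFinset, ψ g⁻¹ := by
  rw [finsum_mem_eq_finite_toFinset_sum _ (finite_galoisClass hχ), MonoidAlgebra.coeff_sum,
    Finset.sum_apply', Finset.mul_sum]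
  refine Finset.sum_congr rfl fun ψ hψ => ?_
  rw [coeff_charIdempotent, apply_one_of_mem_galoisClass hχ
    ((finite_galoisClass hχ).mem_toFinset.mp hψ)]

variable {e : ℚ_[p][G]} {χ : G → ℂ_[p]}

theorem coeff_of_mem_characterClass (hχ : χ ∈ characterClass p e) (g : G) :
    algebraMap ℚ_[p] ℂ_[p] (e.coeff g) =
      χ 1 * (Fintype.card G : ℂ_[p])⁻¹ * ∑ ψ ∈ (finite_galoisClass hχ.1).toFinset, ψ g⁻¹ := by
  rw [← coeff_finsum_charIdempotent hχ.1, ← hχ.2, MonoidAlgebra.coeff_mapAlgHom]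
  rfl

theorem coeff_mul_one_eq_sum {k : Type*} [CommSemiring k] (x y : k[G]) :
    (x * y).coeff 1 = ∑ g, x.coeff g⁻¹ * y.coeff g := by
  classical
  rw [MonoidAlgebra.coeff_mul_apply_right, Finsupp.sum_fintype _ _ (by simp)]
  exact Finset.sum_congr rfl fun g _ => by rw [one_mul]

/-- The coefficients of an element of `ℚ_p[G] e` in terms of the characters in the class of `e`. -/
theorem coeff_eq_sum_charEval (hχ : χ ∈ characterClass p e) {x : ℚ_[p][G]} (hx : e * x = x)
    (g : G) :
    algebraMap ℚ_[p] ℂ_[p] (x.coeff g) = χ 1 * (Fintype.card G : ℂ_[p])⁻¹ *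
      ∑ ψ ∈ (finite_galoisClass hχ.1).toFinset,
        charEval ψ (x * MonoidAlgebra.single g⁻¹ 1) := by
  have h1 : x.coeff g = (e * (x * MonoidAlgebra.single g⁻¹ 1)).coeff 1 := by
    rw [← mul_assoc, hx, MonoidAlgebra.coeff_mul_single_apply, inv_inv, one_mul, mul_one]
  rw [h1, coeff_mul_one_eq_sum, map_sum]
  simp only [charEval]
  rw [Finset.sum_comm, Finset.mul_sum]
  refine Finset.sum_congr rfl fun h _ => ?_
  rw [map_mul, coeff_of_mem_characterClass hχ, inv_inv, ← Finset.mul_sum]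
  ring

theorem norm_natCast_padicComplex (d : ℕ) : ‖(d : ℂ_[p])‖ = ‖(d : ℚ_[p])‖ := by
  rw [← map_natCast (algebraMap ℚ_[p] ℂ_[p]), norm_algebraMap']

/-- Zero has to be excluded because `padicValNat p 0 = 0`. -/
theorem norm_natCast_le_iff {a b : ℕ} (ha : a ≠ 0) (hb : b ≠ 0) :
    ‖(a : ℂ_[p])‖ ≤ ‖(b : ℂ_[p])‖ ↔ padicValNat p b ≤ padicValNat p a := by
  have hp : (1 : ℝ) < p := by exact_mod_cast (Fact.out : p.Prime).one_lt
  rw [norm_natCast_padicComplex, norm_natCast_padicComplex,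
    Padic.norm_eq_zpow_neg_valuation (by exact_mod_cast ha),
    Padic.norm_eq_zpow_neg_valuation (by exact_mod_cast hb), Padic.valuation_natCast,
    Padic.valuation_natCast, zpow_le_zpow_iff_right₀ hp]
  omega

theorem hasFullDegreeValuation_iff (hχ : χ ∈ irrCharacters p G) :
    HasFullDegreeValuation p χ ↔ ‖χ 1‖ = ‖(Fintype.card G : ℂ_[p])‖ := by
  obtain ⟨d, hd, hχd⟩ := exists_degree hχ
  have hG : Fintype.card G ≠ 0 := Fintype.card_ne_zero
  rw [hχd]
  constructor
  · rintro ⟨d', hd', hv⟩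
    have : d' = d := by rw [hχd] at hd'; exact_mod_cast hd'.symm
    subst this
    exact le_antisymm ((norm_natCast_le_iff hd.ne' hG).mpr hv.ge)
      ((norm_natCast_le_iff hG hd.ne').mpr hv.le)
  · intro h
    exact ⟨d, hχd, le_antisymm ((norm_natCast_le_iff hG hd.ne').mp h.ge)
      ((norm_natCast_le_iff hd.ne' hG).mp h.le)⟩

theorem mem_integralGroupRing_iff {x : ℚ_[p][G]} :
    x ∈ integralGroupRing p G ↔ ∀ g, ‖x.coeff g‖ ≤ 1 := by
  constructor
  · rintro ⟨y, rfl⟩ g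
    change ‖(MonoidAlgebra.mapAlgHom G (Algebra.ofId ℤ_[p] ℚ_[p]) y).coeff g‖ ≤ 1
    rw [MonoidAlgebra.coeff_mapAlgHom]
    exact PadicInt.norm_le_one _
  · intro h
    refine ⟨MonoidAlgebra.ofCoeff (Finsupp.equivFunOnFinite.symm fun g => ⟨x.coeff g, h g⟩), ?_⟩
    ext g
    change (MonoidAlgebra.mapAlgHom G (Algebra.ofId ℤ_[p] ℚ_[p]) _).coeff g = _
    rw [MonoidAlgebra.coeff_mapAlgHom]
    rfl

/-- An idempotent attached to a class of characters of full degree valuation is integral. -/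
theorem mem_integralGroupRing_of_hasFullDegreeValuation (hχ : χ ∈ characterClass p e)
    (h : HasFullDegreeValuation p χ) : e ∈ integralGroupRing p G := by
  rw [mem_integralGroupRing_iff]
  intro g
  have hG : ‖(Fintype.card G : ℂ_[p])‖ ≠ 0 := by
    rw [norm_ne_zero_iff]; exact_mod_cast Fintype.card_ne_zero
  rw [← norm_algebraMap' ℂ_[p], coeff_of_mem_characterClass hχ, norm_mul, norm_mul, norm_inv,
    (hasFullDegreeValuation_iff hχ.1).mp h, mul_inv_cancel₀ hG, one_mul]
  refine IsUltrametricDist.norm_sum_le_of_forall_le_of_nonneg zero_le_one fun ψ hψ => ?_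
  exact norm_character_le_one (mem_irrCharacters_of_mem_galoisClass hχ.1
    ((finite_galoisClass hχ.1).mem_toFinset.mp hψ)) _

end CharacterClass

/-! ### Integral idempotents force full degree valuation -/

section FullDegree

variable {p : ℕ} [Fact p.Prime] {G : Type*} [Group G] [Fintype G] {e : ℚ_[p][G]} {χ : G → ℂ_[p]}

omit [Fintype G] in
theorem MonoidAlgebra.coeff_conj_eq {k : Type*} [CommRing k] {z : k[G]}
    (hz : ∀ a, z * a = a * z) (g h : G) : z.coeff (h * g * h⁻¹) = z.coeff g := by
  have := congrArg (fun x => x.coeff (h * g)) (hz (MonoidAlgebra.single h 1))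
  simpa [mul_assoc] using this

omit [Fintype G] in
theorem MonoidAlgebra.mul_comm_of_coeff_conj_eq {k : Type*} [CommRing k] {z : k[G]}
    (hz : ∀ g h : G, z.coeff (h * g * h⁻¹) = z.coeff g) (a : k[G]) : z * a = a * z := by
  induction a using MonoidAlgebra.induction_linear with
  | zero => rw [mul_zero, zero_mul]
  | add x y hx hy => rw [mul_add, add_mul, hx, hy]
  | single h r =>
    ext g
    rw [MonoidAlgebra.coeff_mul_single_apply, MonoidAlgebra.coeff_single_mul_apply, mul_comm r,
      ← hz (h⁻¹ * g) h, mul_inv_cancel_left]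

omit [Fintype G] in
theorem complexify_central (central : ∀ a, e * a = a * e) (a : ℂ_[p][G]) :
    complexify p G e * a = a * complexify p G e := by
  refine MonoidAlgebra.mul_comm_of_coeff_conj_eq (fun g h => ?_) a
  rw [MonoidAlgebra.coeff_mapAlgHom, MonoidAlgebra.coeff_mapAlgHom,
    MonoidAlgebra.coeff_conj_eq central]

/-- By Schur, e acts as an idempotent scalar. If that scalar were 0, all conjugate characters would
vanish on e·g and the coefficient formula would give e = 0. -/
theorem padicAction_self_of_mem_characterClass (he : IsCentralPrimitiveIdempotent e)
    (hχ : χ ∈ characterClass p e) {n : ℕ} {ρ : Representation ℂ_[p] G (Fin n → ℂ_[p])}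
    (hρ : ρ.IsIrreducible) (hρχ : ρ.character = χ) : padicAction ρ e = 1 := by
  obtain ⟨ω, hω⟩ := exists_asAlgebraHom_eq_smul hρ (complexify_central he.central)
  rw [← padicAction_apply] at hω
  by_cases h0 : padicAction ρ e = 0
  · exfalso
    apply he.ne_zero
    ext g
    apply (algebraMap ℚ_[p] ℂ_[p]).injective
    rw [coeff_eq_sum_charEval hχ he.idem.eq, Finset.sum_eq_zero, mul_zero]
    · simp
    · intro ψ hψ
      obtain ⟨σ, rfl⟩ := (finite_galoisClass hχ.1).mem_toFinset.mp hψ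
      change charEval (fun g => σ (χ g)) _ = 0
      rw [charEval_comp_algEquiv, ← hρχ, charEval_character, map_mul, h0, zero_mul, map_zero,
        map_zero]
  · have hωv (v : Fin n → ℂ_[p]) : padicAction ρ e v = ω • v := by rw [hω]; rfl
    have h1 : ω * ω = ω := by
      have h2 := LinearMap.congr_fun (congrArg (padicAction ρ) he.idem.eq) fun _ => 1
      rw [map_mul, Module.End.mul_apply, hωv, hωv] at h2
      simpa using congrFun h2 ⟨0, hρ.pos⟩
    have h4 : ω ≠ 0 := fun h => h0 (LinearMap.ext fun v => by rw [hωv, h, zero_smul]; rfl)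
    have h5 : ω = 1 := mul_left_cancel₀ h4 (by rw [h1, mul_one])
    exact LinearMap.ext fun v => by rw [hωv, h5, one_smul]; rfl

/-- The sum of a class function vanishing at elements whose centraliser has order divisible
by `p` is divisible by the `p`-part of the group order. -/
theorem norm_sum_le_of_classFunction {F : G → ℂ_[p]} (hF : ∀ g, ‖F g‖ ≤ 1)
    (hconj : ∀ g h, F (h * g * h⁻¹) = F g)
    (hz : ∀ g u, orderOf u = p → Commute u g → F g = 0) :
    ‖∑ g, F g‖ ≤ ‖(Fintype.card G : ℂ_[p])‖ := by
  classical
  have h1 : ∑ g, F g = ∑ c : ConjClasses G, ∑ g with ConjClasses.mk g = c, F g :=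
    (Finset.sum_fiberwise _ _ _).symm
  rw [h1]
  refine IsUltrametricDist.norm_sum_le_of_forall_le_of_nonneg (norm_nonneg _) fun c _ => ?_
  obtain ⟨g, rfl⟩ := ConjClasses.exists_rep c
  have h2 : ∀ x ∈ Finset.univ.filter (fun x => ConjClasses.mk x = ConjClasses.mk g), F x = F g := by
    intro x hx
    rw [Finset.mem_filter, ConjClasses.mk_eq_mk_iff_isConj] at hx
    obtain ⟨h, hh⟩ := isConj_iff.mp hx.2.symm
    rw [← hh, hconj]
  rw [Finset.sum_congr rfl h2, Finset.sum_const, nsmul_eq_mul]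
  -- If p divides the centraliser order, Cauchy supplies a u of order p and the class contributes 0.
  -- Otherwise the class length has the same p-adic norm as |G|.
  by_cases hp : p ∣ Nat.card (Subgroup.centralizer {g})
  · obtain ⟨u, hu⟩ := exists_prime_orderOf_dvd_card' p hp
    have : F g = 0 := by
      refine hz g u.1 (by rw [Subgroup.orderOf_coe, hu]) ?_
      exact (Subgroup.mem_centralizer_singleton_iff.mp u.2)
    rw [this, mul_zero, norm_zero]
    exact norm_nonneg _
  · have h3 : Fintype.card G =
        (Finset.univ.filter fun x => ConjClasses.mk x = ConjClasses.mk g).card *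
          Nat.card (Subgroup.centralizer {g}) := by
      have h4 : (Finset.univ.filter fun x => ConjClasses.mk x = ConjClasses.mk g).card =
          Nat.card (MulAction.orbit (ConjAct G) g) := by
        refine (Nat.subtype_card _ fun x => ?_).symm
        rw [ConjAct.orbit_eq_carrier_conjClasses, Finset.mem_filter,
          ConjClasses.mem_carrier_iff_mk_eq]
        simp
      rw [h4, Subgroup.nat_card_centralizer_nat_card_stabilizer, ← Nat.card_prod,
        Nat.card_congr (MulAction.orbitProdStabilizerEquivGroup (ConjAct G) g),
        ← Nat.card_eq_fintype_card]
      rfl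
    rw [norm_mul, h3, Nat.cast_mul, norm_mul]
    have h4 : ‖(Nat.card (Subgroup.centralizer {g}) : ℂ_[p])‖ = 1 := by
      rw [norm_natCast_padicComplex]
      exact Padic.norm_natCast_eq_one_iff.mpr ((Nat.Prime.coprime_iff_not_dvd Fact.out).mpr hp)
    rw [h4]
    exact mul_le_mul_of_nonneg_left (hF g) (norm_nonneg _)

omit [Fintype G] in
theorem exists_integral_lift {x : ℚ_[p][G]} (hx : x ∈ integralGroupRing p G) :
    ∃ y : ℤ_[p][G], includeCoeff p G y = x := by
  obtain ⟨y, hy⟩ := hx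
  exact ⟨y, hy⟩

omit [Fintype G] in
theorem isIntegral_of_mem_integralGroupRing [Finite G] {x : ℚ_[p][G]}
    (hx : x ∈ integralGroupRing p G) : IsIntegral ℤ_[p] x := by
  have : Module.Finite ℤ_[p] ℤ_[p][G] := Module.Finite.of_basis (MonoidAlgebra.basis G ℤ_[p])
  refine IsIntegral.of_mem_of_fg (integralGroupRing p G) ?_ x hx
  rw [integralGroupRing, ← Module.Finite.iff_fg]
  exact Module.Finite.range (MonoidAlgebra.mapAlgHom G (Algebra.ofId ℤ_[p] ℚ_[p])).toLinearMap

variable {m : ℕ} {D : Type*} [DivisionRing D] [Algebra ℚ_[p] D]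

/-- If `ℚ_p[G] e` is simple and `e` is integral, the degrees of the characters attached to `e`
are divisible by the `p`-part of the group order. -/
theorem norm_apply_one_le_of_mem_integralGroupRing (he : IsCentralPrimitiveIdempotent e)
    (φ : he.idem.Corner ≃ₐ[ℚ_[p]] Matrix (Fin m) (Fin m) D)
    (hint : e ∈ integralGroupRing p G) (hχ : χ ∈ characterClass p e) :
    ‖χ 1‖ ≤ ‖(Fintype.card G : ℂ_[p])‖ := by
  classical
  have hχ1 := hχ.1
  obtain ⟨n, ρ, hρ, hρχ⟩ := hχ.1
  have hdvd : ∀ g u, orderOf u = p → Commute u g → ∃ b : ℤ_[p], e.coeff g = p * b := by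
    obtain ⟨e', rfl⟩ := exists_integral_lift hint
    intro g u hu hg
    obtain ⟨b, hb⟩ := dvd_coeff_of_commute he.idem he.central φ hu hg
    exact ⟨b, by rw [MonoidAlgebra.coeff_mapRingHom, hb]; simp⟩
  let P : G → Prop := fun g => ∃ u, orderOf u = p ∧ Commute u g
  have hPconj_of (g h) (hg : P g) : P (h * g * h⁻¹) := by
    obtain ⟨u, hu, hug⟩ := hg
    exact ⟨MulAut.conj h u, by rw [MulEquiv.orderOf_eq, hu], hug.map (MulAut.conj h)⟩
  have hPconj (g h) : P (h * g * h⁻¹) ↔ P g :=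
    ⟨fun hg => by simpa [mul_assoc] using hPconj_of _ h⁻¹ hg, hPconj_of g h⟩
  have hp0 : (p : ℚ_[p]) ≠ 0 := by exact_mod_cast (Fact.out : p.Prime).ne_zero
  -- The part of e supported on elements commuting with some element of order p, divided by p. It is
  -- integral by `hdvd`, and central because `P` is conjugation invariant.
  let y : ℚ_[p][G] := MonoidAlgebra.ofCoeff (Finsupp.equivFunOnFinite.symm fun g =>
    if P g then (p : ℚ_[p])⁻¹ * e.coeff g else 0)
  have hy (g) : y.coeff g = if P g then (p : ℚ_[p])⁻¹ * e.coeff g else 0 := rfl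
  have hyint : y ∈ integralGroupRing p G := by
    rw [mem_integralGroupRing_iff]
    intro g
    rw [hy]
    split_ifs with hg
    · obtain ⟨u, hu, hug⟩ := hg
      obtain ⟨b, hb⟩ := hdvd g u hu hug
      rw [hb, inv_mul_cancel_left₀ hp0]
      exact PadicInt.norm_le_one b
    · simp
  have hycentral : ∀ a, y * a = a * y := MonoidAlgebra.mul_comm_of_coeff_conj_eq fun g h => by
    rw [hy, hy, MonoidAlgebra.coeff_conj_eq he.central]
    simp only [hPconj]
  obtain ⟨ω, hω⟩ := exists_asAlgebraHom_eq_smul hρ (complexify_central hycentral)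
  have hω1 : ‖ω‖ ≤ 1 := by
    refine norm_eigenvalue_le_one (isIntegral_of_mem_integralGroupRing hyint) (ρ := ρ) ?_
    refine Module.End.hasEigenvalue_of_hasEigenvector (x := fun _ => 1) <|
      Module.End.hasEigenvector_iff.mpr ⟨Module.End.mem_eigenspace_iff.mpr ?_, fun h => ?_⟩
    · rw [padicAction_apply, hω]; rfl
    · simpa using congrFun h ⟨0, hρ.pos⟩
  have hχy : charEval χ y = ω * χ 1 := by
    rw [← hρχ, charEval_character, padicAction_apply, hω, Representation.char_one]
    have : LinearMap.trace ℂ_[p] (Fin n → ℂ_[p]) (ω • 1) = ω * LinearMap.trace ℂ_[p] (Fin n → ℂ_[p]) 1 :=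
      map_smul (LinearMap.trace ℂ_[p] (Fin n → ℂ_[p])) ω 1
    rw [LinearMap.trace_one] at this
    exact this
  have hχe : charEval χ e = χ 1 := by
    rw [← hρχ, charEval_character, padicAction_self_of_mem_characterClass he hχ hρ hρχ]
    simp
  -- The full sum is χ(e) = χ(1) and the removed part is pχ(y) = pωχ(1). The factor 1 - pω is a unit
  -- since ω is integral.
  have hsplit : ∑ g, (if P g then 0 else algebraMap ℚ_[p] ℂ_[p] (e.coeff g) * χ g) =
      (1 - p * ω) * χ 1 := by
    rw [sub_mul, one_mul, mul_assoc, ← hχy, ← hχe, charEval, charEval, Finset.mul_sum,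
      ← Finset.sum_sub_distrib]
    refine Finset.sum_congr rfl fun g _ => ?_
    rw [hy]
    split_ifs with hg
    · rw [map_mul, map_inv₀, map_natCast, ← mul_assoc, ← mul_assoc, mul_inv_cancel₀, one_mul,
        sub_self]
      exact_mod_cast (Fact.out : p.Prime).ne_zero
    · simp
  have hnorm : ‖(1 - p * ω : ℂ_[p])‖ = 1 := by
    have hlt : ‖(p * ω : ℂ_[p])‖ < 1 := by
      rw [norm_mul, norm_natCast_padicComplex]
      exact mul_lt_one_of_nonneg_of_lt_one_left (norm_nonneg _) Padic.norm_p_lt_one hω1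
    rw [sub_eq_add_neg, IsUltrametricDist.norm_add_eq_max_of_norm_ne_norm, norm_neg, norm_one,
      max_eq_left hlt.le]
    rw [norm_neg, norm_one]
    exact hlt.ne'
  have hfin := norm_sum_le_of_classFunction (p := p)
    (F := fun g => if P g then 0 else algebraMap ℚ_[p] ℂ_[p] (e.coeff g) * χ g)
    (fun g => by
      split_ifs
      · simp
      · rw [norm_mul, norm_algebraMap']
        exact mul_le_one₀ (mem_integralGroupRing_iff.mp hint g) (norm_nonneg _)
          (norm_character_le_one hχ.1 g))
    (fun g h => by
      rw [MonoidAlgebra.coeff_conj_eq he.central, ← hρχ, Representation.char_conj]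
      simp only [hPconj])
    (fun g u hu hug => if_pos ⟨u, hu, hug⟩)
  rwa [hsplit, norm_mul, hnorm, one_mul] at hfin

/-- Otherwise r = |χ(1)|/||G|| < 1 bounds every coefficient of e, and expanding e = e^k bounds them
by r^k for all k, so e = 0. -/
theorem norm_le_apply_one_of_isIdempotentElem (he : IsCentralPrimitiveIdempotent e)
    (hχ : χ ∈ characterClass p e) : ‖(Fintype.card G : ℂ_[p])‖ ≤ ‖χ 1‖ := by
  by_contra! hlt
  have hG : 0 < ‖(Fintype.card G : ℂ_[p])‖ := by
    rw [norm_pos_iff]; exact_mod_cast Fintype.card_ne_zero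
  set r := ‖χ 1‖ * ‖(Fintype.card G : ℂ_[p])‖⁻¹ with hr
  have hr0 : 0 ≤ r := by positivity
  have hr1 : r < 1 := by rwa [hr, ← div_eq_mul_inv, div_lt_one hG]
  have hcoeff (g) : ‖e.coeff g‖ ≤ r := by
    rw [← norm_algebraMap' ℂ_[p], coeff_of_mem_characterClass hχ, norm_mul, norm_mul, norm_inv]
    refine mul_le_of_le_one_right hr0 ?_
    refine IsUltrametricDist.norm_sum_le_of_forall_le_of_nonneg zero_le_one fun ψ hψ => ?_
    exact norm_character_le_one (mem_irrCharacters_of_mem_galoisClass hχ.1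
      ((finite_galoisClass hχ.1).mem_toFinset.mp hψ)) _
  have hpow (k : ℕ) : ∀ g, ‖e.coeff g‖ ≤ r ^ (k + 1) := by
    induction k with
    | zero => simpa using hcoeff
    | succ k ih =>
      intro g
      have h1 : e.coeff g = (e * (e * MonoidAlgebra.single g⁻¹ 1)).coeff 1 := by
        rw [← mul_assoc, he.idem.eq, MonoidAlgebra.coeff_mul_single_apply, inv_inv, one_mul,
          mul_one]
      rw [h1, coeff_mul_one_eq_sum]
      refine IsUltrametricDist.norm_sum_le_of_forall_le_of_nonneg (by positivity) fun h _ => ?_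
      rw [norm_mul, pow_succ, MonoidAlgebra.coeff_mul_single_apply, mul_one]
      exact mul_le_mul (ih _) (hcoeff _) (norm_nonneg _) (by positivity)
  apply he.ne_zero
  ext g
  have h0 : ‖e.coeff g‖ ≤ 0 :=
    ge_of_tendsto' ((tendsto_pow_atTop_nhds_zero_of_lt_one hr0 hr1).comp
      (Filter.tendsto_add_atTop_nat 1)) fun k => hpow k g
  simpa using h0

theorem hasFullDegreeValuation_of_mem_integralGroupRing (he : IsCentralPrimitiveIdempotent e)
    (φ : he.idem.Corner ≃ₐ[ℚ_[p]] Matrix (Fin m) (Fin m) D)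
    (hint : e ∈ integralGroupRing p G) (hχ : χ ∈ characterClass p e) :
    HasFullDegreeValuation p χ :=
  (hasFullDegreeValuation_iff hχ.1).mpr
    (le_antisymm (norm_apply_one_le_of_mem_integralGroupRing he φ hint hχ)
      (norm_le_apply_one_of_isIdempotentElem he hχ))

end FullDegree

/-! ### Existence of the class of characters attached to e -/

section NonemptyClass

variable {p : ℕ} [Fact p.Prime] {G : Type*} [Group G] [Fintype G] {e : ℚ_[p][G]} {χ ψ : G → ℂ_[p]}

instance MonoidAlgebra.neZero_natCard_padicComplex : NeZero (Nat.card G : ℂ_[p]) :=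
  ⟨by exact_mod_cast Nat.card_pos.ne'⟩

theorem MonoidAlgebra.eq_of_forall_asAlgebraHom_eq {x y : ℂ_[p][G]}
    (h : ∀ (n : ℕ) (ρ : Representation ℂ_[p] G (Fin n → ℂ_[p])), ρ.IsIrreducible →
      ρ.asAlgebraHom x = ρ.asAlgebraHom y) : x = y := by
  by_contra hne
  obtain ⟨n, ρ, hρ, h0⟩ := exists_isIrreducible_asAlgebraHom_ne_zero (sub_ne_zero.mpr hne)
  exact h0 (by rw [map_sub, h n ρ hρ, sub_self])

omit [Fintype G] in
theorem trace_smul_one {n : ℕ} (ω : ℂ_[p]) :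
    LinearMap.trace ℂ_[p] (Fin n → ℂ_[p]) (ω • 1) = ω * n := by
  have : LinearMap.trace ℂ_[p] (Fin n → ℂ_[p]) (ω • 1) =
      ω * LinearMap.trace ℂ_[p] (Fin n → ℂ_[p]) 1 :=
    map_smul (LinearMap.trace ℂ_[p] (Fin n → ℂ_[p])) ω 1
  rw [this, LinearMap.trace_one]
  simp

theorem charIdempotent_central (hψ : ψ ∈ irrCharacters p G) (a : ℂ_[p][G]) :
    charIdempotent p ψ * a = a * charIdempotent p ψ := by
  obtain ⟨n, ρ, -, rfl⟩ := hψ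
  refine MonoidAlgebra.mul_comm_of_coeff_conj_eq (fun g h => ?_) a
  rw [coeff_charIdempotent, coeff_charIdempotent, conj_inv, Representation.char_conj]

-- Schur makes the action a scalar ω. Taking traces gives ωn = ψ(1)⟨ρ, ψ⟩, and orthonormality of
-- characters finishes.
open scoped Classical in
theorem asAlgebraHom_charIdempotent (hψ : ψ ∈ irrCharacters p G) {n : ℕ}
    {ρ : Representation ℂ_[p] G (Fin n → ℂ_[p])} (hρ : ρ.IsIrreducible) :
    ρ.asAlgebraHom (charIdempotent p ψ) = if ρ.character = ψ then 1 else 0 := by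
  have hn : (n : ℂ_[p]) ≠ 0 := by exact_mod_cast hρ.pos.ne'
  have hcard : (Nat.card G : ℂ_[p]) ≠ 0 := NeZero.ne _
  let _ : Invertible (Nat.card G : ℂ_[p]) := invertibleOfNonzero hcard
  obtain ⟨ω, hω⟩ := exists_asAlgebraHom_eq_smul hρ (charIdempotent_central hψ)
  have h1 : ω * n = ψ 1 * ((Nat.card G : ℂ_[p])⁻¹ * ∑ g, ρ.character g * ψ g⁻¹) := by
    rw [← trace_smul_one, ← hω, charIdempotent, map_sum, map_sum, Finset.mul_sum, Finset.mul_sum,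
      Nat.card_eq_fintype_card]
    refine Finset.sum_congr rfl fun g _ => ?_
    rw [Representation.asAlgebraHom_single]
    refine (map_smul (LinearMap.trace ℂ_[p] (Fin n → ℂ_[p])) _ (ρ g)).trans ?_
    rw [smul_eq_mul, Representation.character]
    ring
  obtain ⟨n', ρ', hρ', rfl⟩ := hψ
  rw [Representation.char_orthonormal] at h1
  have hωv (v : Fin n → ℂ_[p]) : ρ.asAlgebraHom (charIdempotent p ρ'.character) v = ω • v := by
    rw [hω]; rfl
  split_ifs with h
  · have h2 : ω = 1 := by
      refine mul_right_cancel₀ hn ?_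
      rw [one_mul, h1, ← h, if_pos, Representation.char_one, finrank_fin_fun, mul_one]
      -- Two representations with the same character must be isomorphic: otherwise the same inner
      -- product would be both 0 and 1.
      by_contra hE
      have h3 := Representation.char_orthonormal ρ ρ'
      have h4 := Representation.char_orthonormal ρ ρ
      rw [if_neg hE, ← h, h4, if_pos ⟨Representation.Equiv.refl ρ⟩] at h3
      exact one_ne_zero h3
    exact LinearMap.ext fun v => by rw [hωv, h2, one_smul]; rfl
  · have h2 : ω = 0 := by
      refine mul_right_cancel₀ hn ?_
      rw [h1, if_neg, mul_zero, zero_mul]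
      rintro ⟨f⟩
      exact h (Representation.char_iso f).symm
    exact LinearMap.ext fun v => by rw [hωv, h2, zero_smul]; rfl

open scoped Classical in
theorem asAlgebraHom_finsum_charIdempotent (hχ : χ ∈ irrCharacters p G) {n : ℕ}
    {ρ : Representation ℂ_[p] G (Fin n → ℂ_[p])} (hρ : ρ.IsIrreducible) :
    ρ.asAlgebraHom (∑ᶠ ψ ∈ galoisClass p χ, charIdempotent p ψ) =
      if ρ.character ∈ galoisClass p χ then 1 else 0 := by
  rw [finsum_mem_eq_finite_toFinset_sum _ (finite_galoisClass hχ), map_sum,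
    Finset.sum_congr rfl fun ψ hψ => asAlgebraHom_charIdempotent
      (mem_irrCharacters_of_mem_galoisClass hχ ((finite_galoisClass hχ).mem_toFinset.mp hψ)) hρ,
    Finset.sum_ite_eq]
  simp only [Set.Finite.mem_toFinset]

/-- The coefficients are algebraic, and automorphisms of ℂ_p only permute the summands, so they lie
in ℚ_p. -/
theorem exists_complexify_eq_finsum_charIdempotent (hχ : χ ∈ irrCharacters p G) :
    ∃ c : ℚ_[p][G], complexify p G c = ∑ᶠ ψ ∈ galoisClass p χ, charIdempotent p ψ := by
  set c := ∑ᶠ ψ ∈ galoisClass p χ, charIdempotent p ψ with hc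
  have key (g) : ∃ q, algebraMap ℚ_[p] ℂ_[p] q = c.coeff g := by
    rw [hc, coeff_finsum_charIdempotent hχ]
    refine mem_range_algebraMap_of_forall_algEquiv ?_ fun σ => ?_
    · obtain ⟨d, -, hd⟩ := exists_degree hχ
      rw [hd]
      refine ((isAlgebraic_natCast _).mul (isAlgebraic_natCast _).inv).mul
        (IsIntegral.sum _ fun ψ hψ => ?_).isAlgebraic
      exact (isAlgebraic_character (mem_irrCharacters_of_mem_galoisClass hχ
        ((finite_galoisClass hχ).mem_toFinset.mp hψ)) _).isIntegral
    · obtain ⟨d, -, hd⟩ := exists_degree hχ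
      rw [map_mul, map_mul, map_inv₀, map_natCast, hd, map_natCast, map_sum]
      congr 1
      refine Finset.sum_nbij (fun ψ g => σ (ψ g)) (fun ψ hψ => ?_) (fun ψ _ ψ' _ h => ?_)
        (fun ψ hψ => ?_) fun _ _ => rfl
      · obtain ⟨τ, rfl⟩ := (finite_galoisClass hχ).mem_toFinset.mp hψ
        exact (finite_galoisClass hχ).mem_toFinset.mpr ⟨τ.trans σ, rfl⟩
      · exact funext fun g => σ.injective (congrFun h g)
      · obtain ⟨τ, rfl⟩ := (finite_galoisClass hχ).mem_toFinset.mp (Finset.mem_coe.mp hψ)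
        exact ⟨fun g => σ.symm (τ (χ g)), (finite_galoisClass hχ).mem_toFinset.mpr
          ⟨τ.trans σ.symm, rfl⟩, funext fun g => σ.apply_symm_apply _⟩
  choose q hq using key
  refine ⟨MonoidAlgebra.ofCoeff (Finsupp.equivFunOnFinite.symm q), ?_⟩
  ext g
  rw [MonoidAlgebra.coeff_mapAlgHom]
  exact hq g

omit [Fintype G] in
theorem complexify_injective : Function.Injective (complexify p G) := fun x y h => by
  ext g
  apply (algebraMap ℚ_[p] ℂ_[p]).injective
  have := congrArg (fun z => z.coeff g) h
  rw [MonoidAlgebra.coeff_mapAlgHom, MonoidAlgebra.coeff_mapAlgHom] at this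
  exact this

theorem eq_one_of_smul_idempotent {n : ℕ} (hn : 0 < n) {ω : ℂ_[p]} {T : End ℂ_[p] (Fin n → ℂ_[p])}
    (hT : T = ω • 1) (h0 : T ≠ 0) (hidem : T * T = T) : T = 1 := by
  have hωv (v : Fin n → ℂ_[p]) : T v = ω • v := by rw [hT]; rfl
  have h1 : ω * ω = ω := by
    have h2 := LinearMap.congr_fun hidem fun _ => 1
    rw [Module.End.mul_apply, hωv, hωv] at h2
    simpa using congrFun h2 ⟨0, hn⟩
  have h4 : ω ≠ 0 := fun h => h0 (LinearMap.ext fun v => by rw [hωv, h, zero_smul]; rfl)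
  have h5 : ω = 1 := mul_left_cancel₀ h4 (by rw [h1, mul_one])
  exact LinearMap.ext fun v => by rw [hωv, h5, one_smul]; rfl

/-- A central primitive idempotent of `ℚ_p[G]` has an attached class of characters. -/
theorem nonempty_characterClass (he : IsCentralPrimitiveIdempotent e) :
    (characterClass p e).Nonempty := by
  have hce : complexify p G e ≠ 0 := fun h => he.ne_zero (complexify_injective (by rw [h, map_zero]))
  obtain ⟨n, ρ, hρ, hρe⟩ := exists_isIrreducible_asAlgebraHom_ne_zero hce
  have hχ : ρ.character ∈ irrCharacters p G := ⟨n, ρ, hρ, rfl⟩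
  obtain ⟨c, hc⟩ := exists_complexify_eq_finsum_charIdempotent hχ
  have hact {n'} {ρ' : Representation ℂ_[p] G (Fin n' → ℂ_[p])} (hρ' : ρ'.IsIrreducible) :=
    asAlgebraHom_finsum_charIdempotent hχ hρ'
  rw [← hc] at hact
  have hcc : ∀ a, c * a = a * c := fun a => complexify_injective <| by
    refine MonoidAlgebra.eq_of_forall_asAlgebraHom_eq fun n' ρ' hρ' => ?_
    rw [map_mul, map_mul, map_mul, map_mul, hact hρ']
    split_ifs <;> simp
  have hcidem : c * c = c := complexify_injective <| by
    refine MonoidAlgebra.eq_of_forall_asAlgebraHom_eq fun n' ρ' hρ' => ?_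
    rw [map_mul, map_mul, hact hρ']
    split_ifs <;> simp
  obtain ⟨ω, hω⟩ := exists_asAlgebraHom_eq_smul hρ (complexify_central he.central)
  have hone : ρ.asAlgebraHom (complexify p G e) = 1 :=
    eq_one_of_smul_idempotent hρ.pos hω hρe (by rw [← map_mul, ← map_mul, he.idem.eq])
  have hχe : charEval ρ.character e = n := by
    rw [charEval_character, padicAction_apply, hone, LinearMap.trace_one, finrank_fin_fun]
  -- It suffices to see that e acts as 1 wherever c does, that is, on the conjugates of χ. There e
  -- is an idempotent scalar whose trace is σ(n) = n ≠ 0.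
  have hce' : c * e = c := complexify_injective <| by
    refine MonoidAlgebra.eq_of_forall_asAlgebraHom_eq fun n' ρ' hρ' => ?_
    rw [map_mul, map_mul, hact hρ']
    split_ifs with h
    · rw [one_mul]
      obtain ⟨ω', hω'⟩ := exists_asAlgebraHom_eq_smul hρ' (complexify_central he.central)
      have h1 : n' = n := by
        have := apply_one_of_mem_galoisClass hχ h
        rw [Representation.char_one, Representation.char_one, finrank_fin_fun,
          finrank_fin_fun] at this
        exact_mod_cast this
      have h2 : charEval ρ'.character e = n := by
        obtain ⟨σ, hσ⟩ := h
        rw [← hσ, charEval_comp_algEquiv, hχe, map_natCast]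
      rw [charEval_character, padicAction_apply] at h2
      refine eq_one_of_smul_idempotent hρ'.pos hω' (fun h0 => ?_)
        (by rw [← map_mul, ← map_mul, he.idem.eq])
      rw [h0, map_zero] at h2
      exact hρ.pos.ne (by exact_mod_cast h2)
    · rw [zero_mul]
  have hc0 : c ≠ 0 := by
    rintro rfl
    have := hact hρ
    rw [if_pos (self_mem_galoisClass _), map_zero, map_zero] at this
    have h2 := congrFun (LinearMap.congr_fun this fun _ => 1) ⟨0, hρ.pos⟩
    simp at h2
  have hcE := (he.primitive c hcidem hcc hce').resolve_left hc0
  exact ⟨ρ.character, hχ, by rw [← hc, hcE]⟩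

end NonemptyClass

/-! ### Integrality along multiplicative linear maps -/

section IntegralityTransport

variable {R A B : Type*} [CommRing R] [Ring A] [Ring B] [Algebra R A] [Algebra R B]

/-- The map f need not preserve 1, as for the inclusion of a corner. The factor X removes the
constant term, the only place where 1 would enter. -/
theorem map_aeval_X_mul (f : B →ₗ[R] A) (hf : ∀ x y, f (x * y) = f x * f y) (P : Polynomial R)
    (b : B) : f (Polynomial.aeval b (P * Polynomial.X)) =
      Polynomial.aeval (f b) (P * Polynomial.X) := by
  have hpow (n : ℕ) : f (b ^ (n + 1)) = f b ^ (n + 1) := by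
    induction n with
    | zero => simp
    | succ n ih => rw [pow_succ, hf, ih, ← pow_succ]
  induction P using Polynomial.induction_on' with
  | add P Q hP hQ => rw [add_mul, map_add, map_add, map_add, hP, hQ]
  | monomial n a =>
    rw [Polynomial.monomial_mul_X, Polynomial.aeval_monomial, Polynomial.aeval_monomial,
      ← Algebra.smul_def, ← Algebra.smul_def, map_smul, hpow]

theorem IsIntegral.map_of_map_mul (f : B →ₗ[R] A) (hf : ∀ x y, f (x * y) = f x * f y) {b : B}
    (hb : IsIntegral R b) : IsIntegral R (f b) := by
  obtain ⟨P, hP, hPb⟩ := hb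
  refine ⟨P * Polynomial.X, hP.mul Polynomial.monic_X, ?_⟩
  change Polynomial.aeval (f b) _ = 0
  have hPb' : Polynomial.aeval b P = 0 := hPb
  rw [← map_aeval_X_mul f hf, map_mul, hPb', zero_mul, map_zero]

theorem IsIntegral.of_map_of_map_mul (f : B →ₗ[R] A) (hf : ∀ x y, f (x * y) = f x * f y)
    (hinj : Function.Injective f) {b : B} (hb : IsIntegral R (f b)) : IsIntegral R b := by
  obtain ⟨P, hP, hPb⟩ := hb
  refine ⟨P * Polynomial.X, hP.mul Polynomial.monic_X, ?_⟩
  change Polynomial.aeval b _ = 0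
  apply hinj
  have hPb' : Polynomial.aeval (f b) P = 0 := hPb
  rw [map_aeval_X_mul f hf, map_zero, map_mul, hPb', zero_mul]

end IntegralityTransport

/-! ### Self-duality of ℤ_p[G]e and maximality -/

section FullDegreeDual

variable {p : ℕ} [Fact p.Prime] {G : Type*} [Group G] [Fintype G] {e x : ℚ_[p][G]} {χ : G → ℂ_[p]}

/-- Here χ(1)/|G| has norm 1, so coefficients have the same norms as traces: ℤ_p[G]e is its own dual
for the trace form. -/
theorem norm_coeff_eq_norm_sum_charEval (hχ : χ ∈ characterClass p e)
    (hfull : HasFullDegreeValuation p χ) (hx : e * x = x) (g : G) :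
    ‖x.coeff g‖ = ‖∑ ψ ∈ (finite_galoisClass hχ.1).toFinset,
        charEval ψ (x * MonoidAlgebra.single g⁻¹ 1)‖ := by
  have hG : ‖(Fintype.card G : ℂ_[p])‖ ≠ 0 := by
    rw [norm_ne_zero_iff]; exact_mod_cast Fintype.card_ne_zero
  rw [← norm_algebraMap' ℂ_[p], coeff_eq_sum_charEval hχ hx, norm_mul, norm_mul, norm_inv,
    (hasFullDegreeValuation_iff hχ.1).mp hfull, mul_inv_cancel₀ hG, one_mul]

theorem mem_integralGroupRing_of_norm_charEval_le (hχ : χ ∈ characterClass p e)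
    (hfull : HasFullDegreeValuation p χ) (hx : e * x = x)
    (h : ∀ ψ ∈ irrCharacters p G, ∀ g, ‖charEval ψ (x * MonoidAlgebra.single g 1)‖ ≤ 1) :
    x ∈ integralGroupRing p G := by
  rw [mem_integralGroupRing_iff]
  intro g
  rw [norm_coeff_eq_norm_sum_charEval hχ hfull hx]
  exact IsUltrametricDist.norm_sum_le_of_forall_le_of_nonneg zero_le_one fun ψ hψ =>
    h ψ (mem_irrCharacters_of_mem_galoisClass hχ.1 ((finite_galoisClass hχ.1).mem_toFinset.mp hψ)) _

theorem exists_eq_smul_of_norm_charEval_lt (hχ : χ ∈ characterClass p e)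
    (hfull : HasFullDegreeValuation p χ) (hx : e * x = x)
    (h : ∀ ψ ∈ irrCharacters p G, ∀ g, ‖charEval ψ (x * MonoidAlgebra.single g 1)‖ < 1) :
    ∃ w ∈ integralGroupRing p G, x = (p : ℚ_[p]) • w := by
  have hp0 : (p : ℚ_[p]) ≠ 0 := by exact_mod_cast (Fact.out : p.Prime).ne_zero
  refine ⟨(p : ℚ_[p])⁻¹ • x, mem_integralGroupRing_iff.mpr fun g => ?_, by
    rw [smul_smul, mul_inv_cancel₀ hp0, one_smul]⟩
  have hlt : ‖x.coeff g‖ < 1 := by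
    rw [norm_coeff_eq_norm_sum_charEval hχ hfull hx]
    obtain ⟨ψ, hψ, hle⟩ := IsUltrametricDist.exists_norm_finsetSum_le_of_nonempty
      (t := (finite_galoisClass hχ.1).toFinset)
      ⟨χ, (finite_galoisClass hχ.1).mem_toFinset.mpr (self_mem_galoisClass χ)⟩
      fun ψ => charEval ψ (x * MonoidAlgebra.single g⁻¹ 1)
    exact hle.trans_lt (h ψ (mem_irrCharacters_of_mem_galoisClass hχ.1
      ((finite_galoisClass hχ.1).mem_toFinset.mp hψ)) _)
  have hd : (p : ℤ_[p]) ∣ ⟨x.coeff g, hlt.le⟩ := PadicInt.norm_lt_one_iff_dvd _ |>.mp hlt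
  obtain ⟨b, hb⟩ := hd
  have hb' : x.coeff g = p * b := congrArg Subtype.val hb
  rw [MonoidAlgebra.coeff_smul_apply, smul_eq_mul, hb', inv_mul_cancel_left₀ hp0]
  exact PadicInt.norm_le_one b

/-- An integral element of `ℚ_p[G] e` generating a right ideal which is nil modulo `p` is
divisible by `p`. -/
theorem exists_eq_smul_of_forall_pow_eq_smul (hχ : χ ∈ characterClass p e)
    (hfull : HasFullDegreeValuation p χ) (hx : e * x = x)
    (h : ∀ g, ∃ (k : ℕ) (y : ℚ_[p][G]), IsIntegral ℤ_[p] y ∧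
      (x * MonoidAlgebra.single g 1) ^ k = (p : ℚ_[p]) • y) :
    ∃ w ∈ integralGroupRing p G, x = (p : ℚ_[p]) • w := by
  refine exists_eq_smul_of_norm_charEval_lt hχ hfull hx fun ψ hψ g => ?_
  obtain ⟨k, y, hy, hxy⟩ := h g
  exact norm_charEval_lt_one hψ hy hxy

theorem isFullOrder_integralGroupRingMul (he : IsCentralPrimitiveIdempotent e) :
    IsFullOrder ℤ_[p] ℚ_[p] (integralGroupRingMul p he) := by
  constructor
  · have : Module.Finite ℤ_[p] ℤ_[p][G] := Module.Finite.of_basis (MonoidAlgebra.basis G ℤ_[p])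
    have hfg : (Subalgebra.toSubmodule (integralGroupRing p G)).FG := by
      rw [integralGroupRing, ← Module.Finite.iff_fg]
      exact Module.Finite.range (MonoidAlgebra.mapAlgHom G (Algebra.ofId ℤ_[p] ℚ_[p])).toLinearMap
    exact hfg.map (toCorner ℤ_[p] he.idem he.central).toLinearMap
  · rw [eq_top_iff]
    rintro y -
    have hy : y = toCorner ℚ_[p] he.idem he.central y.1 :=
      Subtype.ext ((Subsemigroup.mem_corner_iff he.idem).1 y.2).2.symm
    rw [hy, MonoidAlgebra.eq_sum_single y.1, map_sum]
    refine sum_mem fun g _ => ?_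
    have h1 : (MonoidAlgebra.single g (y.1.coeff g) : ℚ_[p][G]) =
        (y.1.coeff g) • MonoidAlgebra.single g 1 := by
      rw [MonoidAlgebra.smul_single, smul_eq_mul, mul_one]
    rw [h1, map_smul]
    refine Submodule.smul_mem _ _ (Submodule.subset_span ⟨MonoidAlgebra.single g 1, ?_, rfl⟩)
    exact ⟨MonoidAlgebra.single g 1, by simp⟩

/-- For y in a larger order, each y·g is again in that order, hence integral with traces of norm at
most 1; self-duality puts y in ℤ_p[G]. -/
theorem isMaximalOrder_integralGroupRingMul (he : IsCentralPrimitiveIdempotent e)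
    (hχ : χ ∈ characterClass p e) (hfull : HasFullDegreeValuation p χ) :
    IsMaximalOrder ℤ_[p] ℚ_[p] (integralGroupRingMul p he) := by
  refine ⟨isFullOrder_integralGroupRingMul he, fun Γ hΓ hle => le_antisymm (fun y hy => ?_) hle⟩
  have hye := (Subsemigroup.mem_corner_iff he.idem).1 y.2
  have hint : y.1 ∈ integralGroupRing p G := by
    refine mem_integralGroupRing_of_norm_charEval_le hχ hfull hye.1 fun ψ hψ g => ?_
    refine norm_charEval_le_one hψ ?_
    have hg : toCorner ℤ_[p] he.idem he.central (MonoidAlgebra.single g 1) ∈ Γ :=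
      hle ⟨_, ⟨MonoidAlgebra.single g 1, by simp⟩, rfl⟩
    have hI := IsIntegral.of_mem_of_fg Γ hΓ.fg _ (mul_mem hy hg)
    have h2 := hI.map_of_map_mul (cornerSubtype he.idem) fun _ _ => rfl
    have h3 : cornerSubtype (R := ℤ_[p]) he.idem
        (y * toCorner ℤ_[p] he.idem he.central (MonoidAlgebra.single g 1)) =
          y.1 * MonoidAlgebra.single g 1 := by
      change y.1 * (MonoidAlgebra.single g 1 * e) = _
      rw [← he.central, ← mul_assoc, hye.2]
    rwa [h3] at h2
  exact ⟨y.1, hint, Subtype.ext hye.2⟩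

end FullDegreeDual

/-! ### The centre is unramified -/

section Unramified

variable {p : ℕ} [Fact p.Prime]

theorem finite_quotient_span_prime (A : Type*) [CommRing A] [Algebra ℤ_[p] A]
    [Module.Finite ℤ_[p] A] : Finite (A ⧸ Ideal.span {(p : A)}) := by
  obtain ⟨n, f, hf⟩ := Module.Finite.exists_fin' ℤ_[p] A
  obtain ⟨t, ht⟩ := (ZMod.ringHom_surjective (PadicInt.toZMod (p := p))).hasRightInverse
  refine Finite.of_surjective (fun c : Fin n → ZMod p =>
    Ideal.Quotient.mk (Ideal.span {(p : A)}) (f fun i => t (c i))) fun q => ?_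
  obtain ⟨a, rfl⟩ := Ideal.Quotient.mk_surjective q
  obtain ⟨v, rfl⟩ := hf a
  refine ⟨fun i => PadicInt.toZMod (v i), ?_⟩
  rw [Ideal.Quotient.eq, ← map_sub, Ideal.mem_span_singleton]
  have h (i) : ∃ b, t (PadicInt.toZMod (v i)) - v i = p * b := by
    change (p : ℤ_[p]) ∣ _
    rw [← PadicInt.toZMod_eq_zero_iff, map_sub, ht, sub_self]
  choose b hb using h
  refine ⟨f b, ?_⟩
  have h2 : ((fun i => t (PadicInt.toZMod (v i))) - v) = (p : ℤ_[p]) • b := funext hb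
  rw [h2, map_smul, Algebra.smul_def, map_natCast]

/-- A finite `ℤ_p`-algebra which is reduced modulo `p` is unramified. -/
theorem unramified_of_forall_pow_eq_mul (A : Type*) [CommRing A] [Algebra ℤ_[p] A]
    [Module.Finite ℤ_[p] A] (hred : ∀ x y : A, x ^ p = p * y → ∃ w, x = p * w) :
    Algebra.Unramified ℤ_[p] A := by
  have hp := (Fact.out : p.Prime)
  let I := Ideal.span {(p : A)}
  have : Finite (A ⧸ I) := finite_quotient_span_prime (p := p) A
  have hp0 : (p : A ⧸ I) = 0 := by
    rw [← map_natCast (Ideal.Quotient.mk I), Ideal.Quotient.eq_zero_iff_mem]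
    exact Ideal.mem_span_singleton_self _
  -- `hred` says that A/p is reduced. Frobenius is then injective, hence surjective since A/p is
  -- finite.
  have hinj : Function.Injective fun x : A ⧸ I => x ^ p := by
    cases subsingleton_or_nontrivial (A ⧸ I)
    · exact Function.injective_of_subsingleton _
    have : CharP (A ⧸ I) p := (CharP.charP_iff_prime_eq_zero hp).mpr hp0
    intro x y hxy
    obtain ⟨a, ha⟩ := Ideal.Quotient.mk_surjective (x - y)
    have h1 : (x - y) ^ p = 0 := by
      rw [sub_pow_expChar, sub_eq_zero]; exact hxy
    rw [← ha, ← map_pow, Ideal.Quotient.eq_zero_iff_mem, Ideal.mem_span_singleton] at h1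
    obtain ⟨y', hy'⟩ := h1
    rw [← sub_eq_zero, ← ha, Ideal.Quotient.eq_zero_iff_mem, Ideal.mem_span_singleton]
    exact hred a y' hy'
  have hsurj := Finite.surjective_of_injective hinj
  have hfrob (x : A) : ∃ y z : A, x = y ^ p + p * z := by
    obtain ⟨q, hq⟩ := hsurj (Ideal.Quotient.mk I x)
    obtain ⟨y, rfl⟩ := Ideal.Quotient.mk_surjective q
    have hq' : Ideal.Quotient.mk I x = Ideal.Quotient.mk I (y ^ p) := by rw [map_pow]; exact hq.symm
    rw [Ideal.Quotient.eq, Ideal.mem_span_singleton] at hq'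
    obtain ⟨z, hz⟩ := hq'
    exact ⟨y, z, by rw [← hz]; ring⟩
  have : Module.Finite ℤ_[p] (Ω[A⁄ℤ_[p]]) := Module.Finite.trans A _
  -- Every x is y^p + pz, so dx = p(y^(p-1)dy + dz). Hence Ω = pΩ, and Nakayama gives Ω = 0.
  have hbot : (⊤ : Submodule ℤ_[p] (Ω[A⁄ℤ_[p]])) = ⊥ := by
    refine Submodule.eq_bot_of_le_smul_of_le_jacobson_bot (Ideal.span {(p : ℤ_[p])}) _
      Module.Finite.fg_top ?_ ?_
    · have hD (x : A) : ∃ ω, KaehlerDifferential.D ℤ_[p] A x = (p : ℤ_[p]) • ω := by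
        obtain ⟨y, z, rfl⟩ := hfrob x
        refine ⟨y ^ (p - 1) • KaehlerDifferential.D ℤ_[p] A y + KaehlerDifferential.D ℤ_[p] A z, ?_⟩
        rw [map_add, Derivation.leibniz_pow, Derivation.leibniz, Derivation.map_natCast, smul_zero,
          add_zero, smul_add, Nat.cast_smul_eq_nsmul, Nat.cast_smul_eq_nsmul,
          Nat.cast_smul_eq_nsmul]
      have hall (ω : Ω[A⁄ℤ_[p]]) : ∃ η, ω = (p : ℤ_[p]) • η := by
        have hω : ω ∈ Submodule.span A (Set.range (KaehlerDifferential.D ℤ_[p] A)) := by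
          rw [KaehlerDifferential.span_range_derivation]; trivial
        induction hω using Submodule.span_induction with
        | mem x hx => obtain ⟨a, rfl⟩ := hx; exact hD a
        | zero => exact ⟨0, by rw [smul_zero]⟩
        | add x y _ _ hx hy =>
          obtain ⟨a, rfl⟩ := hx
          obtain ⟨b, rfl⟩ := hy
          exact ⟨a + b, by rw [smul_add]⟩
        | smul a x _ hx =>
          obtain ⟨b, rfl⟩ := hx
          exact ⟨a • b, by rw [smul_comm]⟩
      intro ω _
      obtain ⟨η, rfl⟩ := hall ω
      exact Submodule.smul_mem_smul (Ideal.mem_span_singleton_self _) trivial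
    · rw [IsLocalRing.jacobson_eq_maximalIdeal _ bot_ne_top, PadicInt.maximalIdeal_eq_span_p]
  exact ⟨⟨Submodule.subsingleton_iff _ |>.mp (subsingleton_of_bot_eq_top hbot.symm)⟩, inferInstance⟩

variable {G : Type*} [Group G] [Fintype G] {e : ℚ_[p][G]} {χ : G → ℂ_[p]}

/-- Centrality gives (ι(x)g)^|G| = ι(x^|G|), so for integral x the products ι(x)g are integral and
ι(x) lies in ℤ_p[G]; thus O_F is finite over ℤ_p. If moreover x^p ∈ pO_F, some power of each ι(x)g
is divisible by p, hence so is x, and O_F/p is reduced. -/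
theorem isUnramifiedOverPadic_of_central_embedding (hχ : χ ∈ characterClass p e)
    (hfull : HasFullDegreeValuation p χ) {F : Type*} [CommRing F] [Algebra ℚ_[p] F]
    (ι : F →ₗ[ℚ_[p]] ℚ_[p][G]) (hmul : ∀ x y, ι (x * y) = ι x * ι y)
    (hinj : Function.Injective ι) (hcentral : ∀ x a, ι x * a = a * ι x)
    (hι : ∀ x, e * ι x = ι x) : IsUnramifiedOverPadic p F := by
  unfold IsUnramifiedOverPadic
  let _ : Algebra ℤ_[p] F := Algebra.compHom F (algebraMap ℤ_[p] ℚ_[p])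
  have : IsScalarTower ℤ_[p] ℚ_[p] F := IsScalarTower.of_algebraMap_eq fun _ => rfl
  have hp0 : (p : ℚ_[p]) ≠ 0 := by exact_mod_cast (Fact.out : p.Prime).ne_zero
  have hcard : 0 < Fintype.card G := Fintype.card_pos
  have hpow (x : F) {n : ℕ} (hn : 1 ≤ n) : ι (x ^ n) = ι x ^ n := by
    induction n, hn using Nat.le_induction with
    | base => simp
    | succ n _ ih => rw [pow_succ, hmul, ih, ← pow_succ]
  have hmulpow (x : F) (g : G) :
      (ι x * MonoidAlgebra.single g 1) ^ Fintype.card G = ι (x ^ Fintype.card G) := by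
    rw [Commute.mul_pow (hcentral x _), MonoidAlgebra.single_pow, one_pow, pow_card_eq_one,
      ← MonoidAlgebra.one_def, mul_one, hpow x hcard]
  have hint {x : F} (hx : IsIntegral ℤ_[p] x) : IsIntegral ℤ_[p] (ι x) :=
    hx.map_of_map_mul (ι.restrictScalars ℤ_[p]) hmul
  have hmem (x : F) (hx : IsIntegral ℤ_[p] x) : ι x ∈ integralGroupRing p G := by
    refine mem_integralGroupRing_of_norm_charEval_le hχ hfull (hι x) fun ψ hψ g => ?_
    refine norm_charEval_le_one hψ (IsIntegral.of_pow hcard ?_)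
    rw [hmulpow]
    exact hint (hx.pow _)
  have hfin : Module.Finite ℤ_[p] (integralClosure ℤ_[p] F) := by
    have : Module.Finite ℤ_[p] ℤ_[p][G] := Module.Finite.of_basis (MonoidAlgebra.basis G ℤ_[p])
    have : Module.Finite ℤ_[p] (integralGroupRing p G) :=
      Module.Finite.range (MonoidAlgebra.mapAlgHom G (Algebra.ofId ℤ_[p] ℚ_[p])).toLinearMap
    refine Module.Finite.of_injective (((ι.restrictScalars ℤ_[p]).comp
      (integralClosure ℤ_[p] F).val.toLinearMap).codRestrict
        (Subalgebra.toSubmodule (integralGroupRing p G)) fun x => hmem x.1 x.2) ?_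
    intro x y h
    exact Subtype.ext (hinj (congrArg Subtype.val h))
  refine unramified_of_forall_pow_eq_mul (integralClosure ℤ_[p] F) fun x y hxy => ?_
  have hxy' : x.1 ^ p = p * y.1 := congrArg Subtype.val hxy
  obtain ⟨w, hw, hxw⟩ := exists_eq_smul_of_forall_pow_eq_smul hχ hfull (hι x.1) fun g => by
    -- The exponent |G| removes g and the exponent p turns x into py. One factor p of (py)^|G| is
    -- kept outside the witness.
    refine ⟨Fintype.card G * p, ι ((p : F) ^ (Fintype.card G - 1) * y.1 ^ Fintype.card G),
      hint (((isIntegral_natCast p).pow _).mul (y.2.pow _)), ?_⟩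
    have h1 : (ι x.1 * MonoidAlgebra.single g 1) ^ (Fintype.card G * p) =
        ι ((x.1 ^ p) ^ Fintype.card G) := by
      rw [pow_mul, hmulpow, ← hpow _ (Fact.out : p.Prime).one_le, ← pow_mul, ← pow_mul,
        mul_comm (Fintype.card G)]
    rw [h1, hxy', ← map_smul, mul_pow, Algebra.smul_def, map_natCast, ← mul_assoc, ← pow_succ',
      Nat.sub_add_cancel hcard]
  have hιw : ι ((p : ℚ_[p])⁻¹ • x.1) = w := by
    rw [map_smul, hxw, smul_smul, inv_mul_cancel₀ hp0, one_smul]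
  refine ⟨⟨(p : ℚ_[p])⁻¹ • x.1, ?_⟩, Subtype.ext ?_⟩
  · refine IsIntegral.of_map_of_map_mul (ι.restrictScalars ℤ_[p]) hmul hinj ?_
    change IsIntegral ℤ_[p] (ι _)
    rw [hιw]
    exact isIntegral_of_mem_integralGroupRing hw
  · change x.1 = (p : F) * _
    rw [← map_natCast (algebraMap ℚ_[p] F), ← Algebra.smul_def, smul_smul, mul_inv_cancel₀ hp0,
      one_smul]

variable {m : ℕ} {D : Type*} [DivisionRing D] [Algebra ℚ_[p] D]

omit [Fintype G] in
theorem IsCentralPrimitiveIdempotent.matrix_size_pos (he : IsCentralPrimitiveIdempotent e)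
    (φ : he.idem.Corner ≃ₐ[ℚ_[p]] Matrix (Fin m) (Fin m) D) : 0 < m := by
  rcases Nat.eq_zero_or_pos m with rfl | h
  · exact absurd (congrArg Subtype.val (φ.injective (Subsingleton.elim (φ 1) (φ 0)))) he.ne_zero
  · exact h

theorem isUnramifiedOverPadic_center (he : IsCentralPrimitiveIdempotent e)
    (φ : he.idem.Corner ≃ₐ[ℚ_[p]] Matrix (Fin m) (Fin m) D) (hχ : χ ∈ characterClass p e)
    (hfull : HasFullDegreeValuation p χ) :
    IsUnramifiedOverPadic p (Subalgebra.center ℚ_[p] D) := by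
  have : Nonempty (Fin m) := ⟨⟨0, he.matrix_size_pos φ⟩⟩
  let s : Subalgebra.center ℚ_[p] D →ₐ[ℚ_[p]] he.idem.Corner :=
    (φ.symm.toAlgHom.comp (Matrix.scalarAlgHom (Fin m) ℚ_[p])).comp
      (Subalgebra.center ℚ_[p] D).val
  have hs (x) (b : he.idem.Corner) : s x * b = b * s x := by
    apply φ.injective
    rw [map_mul, map_mul]
    have h1 : φ (s x) = Matrix.scalar (Fin m) x.1 := φ.apply_symm_apply _
    rw [h1]
    exact Matrix.scalar_commute _ (fun d => (Subalgebra.mem_center_iff.mp x.2 d).symm) _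
  refine isUnramifiedOverPadic_of_central_embedding hχ hfull
    ((cornerSubtype he.idem).comp s.toLinearMap) (fun x y => ?_) (fun x y h => ?_) (fun x a => ?_)
    fun x => ((Subsemigroup.mem_corner_iff he.idem).1 (s x).2).1
  · change (s (x * y)).1 = (s x).1 * (s y).1
    rw [map_mul]
    rfl
  · have h1 : s x = s y := Subtype.ext h
    exact Subtype.ext (Matrix.scalar_inj.mp (φ.symm.injective h1))
  · change (s x).1 * a = a * (s x).1
    have hx := (Subsemigroup.mem_corner_iff he.idem).1 (s x).2
    have h1 : (s x).1 * (a * e) = a * e * (s x).1 :=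
      congrArg Subtype.val (hs x (toCorner ℚ_[p] he.idem he.central a))
    rw [mul_assoc, hx.1] at h1
    rw [← h1, ← he.central, ← mul_assoc, hx.2]

end Unramified

/-! ### Lifting idempotents from the reduction modulo p -/

section IdempotentLifting

variable {p : ℕ} [Fact p.Prime] {G : Type*} [Group G] [Fintype G]

theorem reduceCoeff_surjective : Function.Surjective (reduceCoeff p G) := by
  obtain ⟨t, ht⟩ := (ZMod.ringHom_surjective (PadicInt.toZMod (p := p))).hasRightInverse
  intro y
  refine ⟨MonoidAlgebra.ofCoeff (Finsupp.equivFunOnFinite.symm fun g => t (y.coeff g)), ?_⟩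
  ext g
  rw [MonoidAlgebra.coeff_mapRingHom]
  exact ht _

omit [Fintype G] in
theorem reduceCoeff_eq_iff {x y : ℤ_[p][G]} :
    reduceCoeff p G x = reduceCoeff p G y ↔ ∀ g, ‖x.coeff g - y.coeff g‖ < 1 := by
  rw [← sub_eq_zero, ← map_sub]
  constructor
  · intro h g
    have := congrArg (fun z => z.coeff g) h
    rw [MonoidAlgebra.coeff_mapRingHom] at this
    exact (PadicInt.norm_lt_one_iff_dvd _).mpr (PadicInt.toZMod_eq_zero_iff.mp this)
  · intro h
    ext g
    rw [MonoidAlgebra.coeff_mapRingHom]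
    exact PadicInt.toZMod_eq_zero_iff.mpr ((PadicInt.norm_lt_one_iff_dvd _).mp (h g))

/-- In `ℤ_p[G]`, the powers of an element come arbitrarily `p`-adically close to an idempotent. -/
theorem exists_isIdempotentElem_reduceCoeff_eq_pow {f x : ℤ_[p][G]} (hf : f * x = x)
    (hf' : x * f = x) : ∃ (f' : ℤ_[p][G]) (n : ℕ), 1 ≤ n ∧ f' * f' = f' ∧ f * f' = f' ∧
      f' * f = f' ∧ reduceCoeff p G f' = reduceCoeff p G x ^ n := by
  let E : ℤ_[p][G] ≃ (G → ℤ_[p]) := 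
    { toFun := fun y g => y.coeff g
      invFun := fun c => MonoidAlgebra.ofCoeff (Finsupp.equivFunOnFinite.symm c)
      left_inv := fun y => by ext g; rfl
      right_inv := fun c => rfl }
  let _ : TopologicalSpace ℤ_[p][G] := TopologicalSpace.induced E inferInstance
  let H : ℤ_[p][G] ≃ₜ (G → ℤ_[p]) := E.toHomeomorphOfIsInducing ⟨rfl⟩
  have : CompactSpace ℤ_[p][G] := H.symm.compactSpace
  have : T2Space ℤ_[p][G] := H.symm.t2Space
  have hcoeff (g : G) : Continuous fun y : ℤ_[p][G] => y.coeff g :=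
    (continuous_apply g).comp H.continuous
  have hright (r : ℤ_[p][G]) : Continuous (· * r) := by
    refine continuous_induced_rng.mpr (continuous_pi fun g => ?_)
    change Continuous fun y => (y * r).coeff g
    simp only [MonoidAlgebra.coeff_mul_apply_right, Finsupp.sum]
    exact continuous_finsetSum _ fun h _ => (hcoeff _).mul continuous_const
  have hleft (r : ℤ_[p][G]) : Continuous (r * ·) := by
    refine continuous_induced_rng.mpr (continuous_pi fun g => ?_)
    change Continuous fun y => (r * y).coeff g
    simp only [MonoidAlgebra.coeff_mul_apply_left, Finsupp.sum]
    exact continuous_finsetSum _ fun h _ => continuous_const.mul (hcoeff _)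
  have hfin : Finite (ZMod p)[G] := Module.finite_of_finite (ZMod p)
  let C : Set (ZMod p)[G] := {c | ∃ n, 1 ≤ n ∧ c = reduceCoeff p G x ^ n}
  -- A closed subsemigroup of the compact space ℤ_p[G]: elements of the corner of f reducing to a
  -- positive power of the reduction of x. A compact semigroup with continuous right translations
  -- contains an idempotent.
  let s : Set ℤ_[p][G] := {y | f * y = y} ∩ {y | y * f = y} ∩
    ⋃ c ∈ C, {y | reduceCoeff p G y = c}
  have hs : IsClosed s := by
    refine ((isClosed_eq (hleft f) continuous_id).inter
      (isClosed_eq (hright f) continuous_id)).inter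
        (Set.Finite.isClosed_biUnion (Set.toFinite C) fun c _ => ?_)
    obtain ⟨c, rfl⟩ := reduceCoeff_surjective c
    simp only [reduceCoeff_eq_iff, Set.ofPred_forall]
    refine isClosed_iInter fun g => ?_
    have hb : {y : ℤ_[p][G] | ‖y.coeff g - c.coeff g‖ < 1} =
        (fun y : ℤ_[p][G] => y.coeff g) ⁻¹' Metric.ball (c.coeff g) 1 := by
      ext y; simp [dist_eq_norm]
    rw [hb]
    exact (IsUltrametricDist.isClosed_ball _ _).preimage (hcoeff g)
  obtain ⟨f', ⟨⟨h1, h2⟩, h3⟩, h4⟩ := exists_idempotent_in_compact_subsemigroup hright s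
    ⟨x, ⟨hf, hf'⟩, Set.mem_biUnion (⟨1, le_rfl, rfl⟩ : _ ∈ C) (pow_one _).symm⟩ hs.isCompact
    (by
      rintro y ⟨⟨hy1, hy2⟩, hy3⟩ z ⟨⟨hz1, hz2⟩, hz3⟩
      simp only [Set.mem_iUnion] at hy3 hz3
      obtain ⟨_, ⟨a, ha, rfl⟩, hy3⟩ := hy3
      obtain ⟨_, ⟨b, hb, rfl⟩, hz3⟩ := hz3
      refine ⟨⟨?_, ?_⟩, Set.mem_biUnion (⟨a + b, by omega, rfl⟩ : _ ∈ C) ?_⟩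
      · change f * (y * z) = y * z
        rw [← mul_assoc, hy1]
      · change y * z * f = y * z
        rw [mul_assoc, hz2]
      · change reduceCoeff p G (y * z) = _
        rw [map_mul, hy3, hz3, pow_add])
  simp only [Set.mem_iUnion] at h3
  obtain ⟨_, ⟨n, hn, rfl⟩, h3⟩ := h3
  exact ⟨f', n, hn, h4, h1, h2, h3⟩

omit [Fintype G] in
theorem eq_zero_of_forall_eq_pow_smul {x : ℤ_[p][G]}
    (h : ∀ N : ℕ, ∃ y, x = (p : ℤ_[p]) ^ N • y) : x = 0 := by
  ext g
  refine PadicInt.eq_zero_of_forall_pow_dvd fun N => ?_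
  obtain ⟨y, rfl⟩ := h N
  exact ⟨y.coeff g, by rw [MonoidAlgebra.coeff_smul_apply, smul_eq_mul]⟩

omit [Fintype G] in
theorem reduceCoeff_ne_zero_of_idempotent {f : ℤ_[p][G]} (hf : f * f = f) (h0 : f ≠ 0) :
    reduceCoeff p G f ≠ 0 := by
  intro h
  obtain ⟨y, hy⟩ := reduceCoeff_eq_zero_iff.mp h
  apply h0
  refine eq_zero_of_forall_eq_pow_smul fun N => ?_
  induction N with
  | zero => exact ⟨f, by simp⟩
  | succ N ih =>
    obtain ⟨z, hz⟩ := ih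
    exact ⟨z * y, by
      conv_lhs => rw [← hf]
      conv_lhs => arg 1; rw [hz]
      conv_lhs => arg 2; rw [hy]
      rw [smul_mul_smul_comm, pow_succ]⟩

/-- A nonzero idempotent of `ℤ_p[G]` lies above a minimal one. -/
theorem exists_minimal_idempotent {e : ℤ_[p][G]} (he : e * e = e) (h0 : e ≠ 0) :
    ∃ f : ℤ_[p][G], f * f = f ∧ e * f = f ∧ f ≠ 0 ∧
      ∀ f', f' * f' = f' → f * f' = f' → f' * f = f' → f' = 0 ∨ f' = f := by
  -- Minimality is obtained by minimising the dimension of the right ideal f ℚ_p[G].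
  let V (f : ℤ_[p][G]) : Submodule ℚ_[p] ℚ_[p][G] :=
    LinearMap.range (LinearMap.mulLeft ℚ_[p] (includeCoeff p G f))
  let S : Set ℤ_[p][G] := {f | f * f = f ∧ e * f = f ∧ f ≠ 0}
  obtain ⟨f, ⟨hf, hef, hf0⟩, hmin⟩ :=
    (measure fun f => finrank ℚ_[p] (V f)).wf.has_min S ⟨e, he, he, h0⟩
  refine ⟨f, hf, hef, hf0, fun f' h1 h2 h3 => or_iff_not_imp_left.mpr fun h4 => ?_⟩
  have hle : V f' ≤ V f := by
    rintro _ ⟨z, rfl⟩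
    refine ⟨includeCoeff p G f' * z, ?_⟩
    rw [LinearMap.mulLeft_apply, LinearMap.mulLeft_apply, ← mul_assoc, ← map_mul, h2]
  have hV : V f' = V f := Submodule.eq_of_le_of_finrank_le hle <| not_lt.mp <|
    hmin f' ⟨h1, by rw [← h2, ← mul_assoc, hef], h4⟩
  obtain ⟨z, hz⟩ : includeCoeff p G f ∈ V f' := by
    rw [hV]
    exact ⟨1, by rw [LinearMap.mulLeft_apply, mul_one]⟩
  rw [LinearMap.mulLeft_apply] at hz
  apply includeCoeff_injective
  rw [← h3, map_mul, ← hz, ← mul_assoc, ← map_mul, h1]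

end IdempotentLifting

/-! ### Corners at a minimal idempotent -/

section FiniteDomain

/-- By Wedderburn a finite domain is a field, and its unit group is cyclic. Positive exponents are
required because a zeroth power, lifted to the group ring, would be 1 and not the idempotent of the
corner. -/
theorem exists_forall_eq_zero_or_eq_pow (Q : Type*) [Ring Q] [IsDomain Q] [Finite Q] :
    ∃ α : Q, ∀ q : Q, q = 0 ∨ ∃ n, 1 ≤ n ∧ q = α ^ n := by
  have hQ := Finite.isDomain_to_isField Q
  let _ : CommRing Q := { (inferInstance : Ring Q) with mul_comm := hQ.mul_comm }
  obtain ⟨u, hu⟩ := IsCyclic.exists_monoid_generator (α := Qˣ)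
  refine ⟨u, fun q => or_iff_not_imp_left.mpr fun hq => ?_⟩
  obtain ⟨v, hv⟩ := hQ.mul_inv_cancel hq
  obtain ⟨n, hn⟩ := hu ⟨q, v, hv, by rw [mul_comm, hv]⟩
  refine ⟨n + Nat.card Qˣ, Nat.le_add_left_of_le Nat.card_pos, ?_⟩
  rw [pow_add, ← Units.val_pow_eq_pow_val u (Nat.card Qˣ), pow_card_eq_one', Units.val_one, mul_one]
  exact (congrArg Units.val hn).symm

end FiniteDomain

section MatrixCorner

variable {m : ℕ} {D : Type*} [DivisionRing D]

/-- If `E M_m(D) E` is commutative for a nonzero idempotent `E`, then `D` is commutative. -/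
theorem mul_comm_of_matrix_corner_comm {E : Matrix (Fin m) (Fin m) D} (h0 : E ≠ 0)
    (hE : E * E = E)
    (h : ∀ X Y, (E * X * E) * (E * Y * E) = (E * Y * E) * (E * X * E)) (c d : D) :
    c * d = d * c := by
  obtain ⟨i, j, hij⟩ : ∃ i j, E i j ≠ 0 := by
    by_contra! hz
    exact h0 (Matrix.ext hz)
  -- With a nonzero entry t of E, this entry is t c t d t. Replacing c, d by t⁻¹c, t⁻¹d turns
  -- commutation in the corner into cd = dc.
  have key (c d : D) : ((E * Matrix.single j i c * E) * (E * Matrix.single j i d * E)) i j =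
      E i j * c * E i j * d * E i j := by
    have h1 : (E * Matrix.single j i c * E) * (E * Matrix.single j i d * E) =
        E * (Matrix.single j i c * E * Matrix.single j i d) * E := by
      simp only [mul_assoc]
      rw [← mul_assoc E E, hE]
    rw [h1, Matrix.single_mul_mul_single]
    simp [Matrix.mul_apply, Matrix.single_apply, mul_assoc, ite_and]
  have h2 := congrFun (congrFun (h (Matrix.single j i ((E i j)⁻¹ * c))
    (Matrix.single j i ((E i j)⁻¹ * d))) i) j
  rw [key, key] at h2
  have h3 := mul_right_cancel₀ hij h2
  simpa [← mul_assoc, hij] using h3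

end MatrixCorner

section MinimalIdempotent

variable {p : ℕ} [Fact p.Prime] {G : Type*} [Group G] [Fintype G] {f x : ℤ_[p][G]}

theorem isNilpotent_or_exists_pow_eq
    (hmin : ∀ f', f' * f' = f' → f * f' = f' → f' * f = f' → f' = 0 ∨ f' = f)
    (hx : f * x = x) (hx' : x * f = x) :
    IsNilpotent (reduceCoeff p G x) ∨ ∃ n, 1 ≤ n ∧ reduceCoeff p G x ^ n = reduceCoeff p G f := by
  obtain ⟨f', n, hn, h1, h2, h3, h4⟩ := exists_isIdempotentElem_reduceCoeff_eq_pow hx hx'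
  rcases hmin f' h1 h2 h3 with rfl | rfl
  · exact Or.inl ⟨n, by rw [← h4, map_zero]⟩
  · exact Or.inr ⟨n, hn, h4.symm⟩

/-- The element fzx of the corner is nilpotent modulo p or has f as a power modulo p. In the first
case (xz)^(k+1) = x(fzx)^k z is nilpotent; in the second x has a left inverse in the reduced corner,
contradicting its nilpotency. -/
theorem isNilpotent_reduceCoeff_mul (hf : f * f = f) (hf0 : f ≠ 0)
    (hmin : ∀ f', f' * f' = f' → f * f' = f' → f' * f = f' → f' = 0 ∨ f' = f)
    (hx : f * x = x) (hx' : x * f = x) (hnil : IsNilpotent (reduceCoeff p G x)) (z : ℤ_[p][G]) :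
    IsNilpotent (reduceCoeff p G (x * z)) := by
  rcases isNilpotent_or_exists_pow_eq hmin (x := f * z * x) (by simp only [← mul_assoc, hf])
    (by rw [mul_assoc, hx']) with h | ⟨n, hn, h⟩
  · obtain ⟨k, hk⟩ := h
    have hpow (k : ℕ) : (x * z) ^ (k + 1) = x * (f * z * x) ^ k * z := by
      induction k with
      | zero => simp
      | succ k ih =>
        rw [pow_succ', ih, pow_succ']
        conv_lhs => arg 1; arg 1; rw [← hx']
        simp only [mul_assoc]
    exact ⟨k + 1, by rw [← map_pow, hpow, map_mul, map_mul, map_pow, hk, mul_zero, zero_mul]⟩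
  · exfalso
    obtain ⟨k, hk⟩ := hnil
    set F := reduceCoeff p G f
    set X := reduceCoeff p G x
    have hFX : F * X = X := by rw [← map_mul, hx]
    let U := reduceCoeff p G (f * z * x) ^ (n - 1) * reduceCoeff p G (f * z)
    have hUX : U * X = F := by
      rw [← h, mul_assoc, ← map_mul, ← pow_succ, Nat.sub_add_cancel hn]
    have hU (k : ℕ) : U ^ (k + 1) * X ^ (k + 1) = F := by
      induction k with
      | zero => rw [zero_add, pow_one, pow_one, hUX]
      | succ k ih =>
        rw [pow_succ U, pow_succ' X, mul_assoc, ← mul_assoc U, hUX, pow_succ' X k,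
          ← mul_assoc F, hFX, ← pow_succ', ih]
    apply reduceCoeff_ne_zero_of_idempotent hf hf0
    change F = 0
    rw [← hU k, pow_succ X, hk, zero_mul, mul_zero]

/-- In the reduced corner each element is nilpotent, hence 0 by `hred`, or has the identity as a
power. So the corner is a finite domain, and a lifts an element whose powers exhaust the nonzero
elements. -/
theorem exists_generator_of_minimal_idempotent (hf : f * f = f) (hf0 : f ≠ 0)
    (hmin : ∀ f', f' * f' = f' → f * f' = f' → f' * f = f' → f' = 0 ∨ f' = f)
    (hred : ∀ x, f * x = x → x * f = x → IsNilpotent (reduceCoeff p G x) → reduceCoeff p G x = 0) :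
    ∃ a : ℤ_[p][G], ∀ b, f * b = b → b * f = b → ∃ (P : Polynomial ℤ_[p]) (c : ℤ_[p][G]),
      f * c = c ∧ c * f = c ∧ b = Polynomial.aeval a P + (p : ℤ_[p]) • c := by
  have hF : IsIdempotentElem (reduceCoeff p G f) := by
    rw [IsIdempotentElem, ← map_mul, hf]
  have hfin : Finite (ZMod p)[G] := Module.finite_of_finite (ZMod p)
  have : Finite hF.Corner := Finite.of_injective (fun q : hF.Corner => q.1) Subtype.val_injective
  have hlift (q : hF.Corner) : ∃ b, f * b = b ∧ b * f = b ∧ reduceCoeff p G b = q.1 := by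
    obtain ⟨y, hy⟩ := reduceCoeff_surjective q.1
    have hq := (Subsemigroup.mem_corner_iff hF).1 q.2
    refine ⟨f * y * f, by simp only [← mul_assoc, hf], by rw [mul_assoc, hf], ?_⟩
    rw [map_mul, map_mul, hy, hq.1, hq.2]
  have : Nontrivial hF.Corner :=
    ⟨1, 0, fun h => reduceCoeff_ne_zero_of_idempotent hf hf0 (congrArg Subtype.val h)⟩
  have : NoZeroDivisors hF.Corner := ⟨by
    intro q r hqr
    refine or_iff_not_imp_left.mpr fun hq => ?_
    obtain ⟨b, hb, hb', hbq⟩ := hlift q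
    rcases isNilpotent_or_exists_pow_eq hmin hb hb' with h | ⟨n, hn, h⟩
    · exact absurd (Subtype.ext (hbq.symm.trans (hred b hb hb' h))) hq
    · apply Subtype.ext
      have hr := (Subsemigroup.mem_corner_iff hF).1 r.2
      change r.1 = 0
      have hbr : reduceCoeff p G b * r.1 = 0 := by
        rw [hbq]
        exact congrArg Subtype.val hqr
      refine hr.1.symm.trans ?_
      generalize r.1 = s at hbr
      rw [← h, ← Nat.sub_add_cancel hn, pow_succ, mul_assoc, hbr, mul_zero]⟩
  have : IsDomain hF.Corner := NoZeroDivisors.to_isDomain _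
  obtain ⟨α, hα⟩ := exists_forall_eq_zero_or_eq_pow hF.Corner
  obtain ⟨a, ha, ha', haα⟩ := hlift α
  have hαpow (n : ℕ) : (α ^ (n + 1)).1 = reduceCoeff p G (a ^ (n + 1)) := by
    induction n with
    | zero => rw [zero_add, pow_one, pow_one, haα]
    | succ n ih =>
      rw [pow_succ a, map_mul, ← ih, haα, pow_succ α]
      rfl
  refine ⟨a, fun b hb hb' => ?_⟩
  obtain ⟨P, hP1, hP2, hP⟩ : ∃ P : Polynomial ℤ_[p], f * Polynomial.aeval a P =
      Polynomial.aeval a P ∧ Polynomial.aeval a P * f = Polynomial.aeval a P ∧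
        reduceCoeff p G b = reduceCoeff p G (Polynomial.aeval a P) := by
    let q : hF.Corner := cornerMk hF (reduceCoeff p G b)
      ⟨by rw [← map_mul, hb], by rw [← map_mul, hb']⟩
    rcases hα q with h | ⟨n, hn, h⟩
    · exact ⟨0, by simp, by simp, by rw [map_zero, map_zero]; exact congrArg Subtype.val h⟩
    · obtain ⟨n, rfl⟩ := Nat.exists_eq_add_of_le' hn
      refine ⟨Polynomial.X ^ (n + 1), ?_, ?_, ?_⟩
      · rw [map_pow, Polynomial.aeval_X, pow_succ', ← mul_assoc, ha]
      · rw [map_pow, Polynomial.aeval_X, pow_succ, mul_assoc, ha']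
      · rw [map_pow, Polynomial.aeval_X, ← hαpow]
        exact congrArg Subtype.val h
  obtain ⟨c, hc⟩ := reduceCoeff_eq_zero_iff.mp
    (show reduceCoeff p G (b - Polynomial.aeval a P) = 0 by rw [map_sub, hP, sub_self])
  refine ⟨P, f * c * f, by simp only [← mul_assoc, hf], by rw [mul_assoc, hf], ?_⟩
  rw [← smul_mul_assoc, ← mul_smul_comm, ← hc, mul_sub, hb, hP1, sub_mul, hb', hP2,
    add_sub_cancel]

-- Iterating the hypothesis writes every element of the corner as a polynomial in a modulo p^N, for
-- each N. Commutators are thus divisible by all powers of p.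
omit [Fintype G] in
theorem commute_of_generator {a : ℤ_[p][G]}
    (ha : ∀ b, f * b = b → b * f = b → ∃ (P : Polynomial ℤ_[p]) (c : ℤ_[p][G]),
      f * c = c ∧ c * f = c ∧ b = Polynomial.aeval a P + (p : ℤ_[p]) • c)
    {b b' : ℤ_[p][G]} (hb : f * b = b ∧ b * f = b) (hb' : f * b' = b' ∧ b' * f = b') :
    b * b' = b' * b := by
  have key (N : ℕ) : ∀ b, f * b = b → b * f = b → ∃ (P : Polynomial ℤ_[p]) (c : ℤ_[p][G]),
      f * c = c ∧ c * f = c ∧ b = Polynomial.aeval a P + (p : ℤ_[p]) ^ N • c := by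
    induction N with
    | zero => exact fun b h h' => ⟨0, b, h, h', by simp⟩
    | succ N ih =>
      intro b h h'
      obtain ⟨P, c, hc, hc', rfl⟩ := ih b h h'
      obtain ⟨Q, d, hd, hd', rfl⟩ := ha c hc hc'
      refine ⟨P + (p : ℤ_[p]) ^ N • Q, d, hd, hd', ?_⟩
      rw [map_add, map_smul, smul_add, smul_smul, pow_succ, add_assoc]
  rw [← sub_eq_zero]
  refine eq_zero_of_forall_eq_pow_smul fun N => ?_
  obtain ⟨P, c, -, -, rfl⟩ := key N b hb.1 hb.2
  obtain ⟨Q, d, -, -, rfl⟩ := key N b' hb'.1 hb'.2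
  have hPQ : Polynomial.aeval a P * Polynomial.aeval a Q =
      Polynomial.aeval a Q * Polynomial.aeval a P := by
    rw [← map_mul, mul_comm, map_mul]
  refine ⟨Polynomial.aeval a P * d + c * Polynomial.aeval a Q + (p : ℤ_[p]) ^ N • (c * d) -
    (Polynomial.aeval a Q * c + d * Polynomial.aeval a P + (p : ℤ_[p]) ^ N • (d * c)), ?_⟩
  simp only [mul_add, add_mul, mul_smul_comm, smul_mul_assoc, hPQ, smul_add, smul_sub]
  abel

end MinimalIdempotent

/-! ### Commutativity of D and the Schur index -/

section SchurIndex

variable {p : ℕ} [Fact p.Prime] {G : Type*} [Group G] [Fintype G] {e : ℚ_[p][G]} {χ : G → ℂ_[p]}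

theorem reduceCoeff_eq_zero_of_forall_isNilpotent (hχ : χ ∈ characterClass p e)
    (hfull : HasFullDegreeValuation p χ) {x : ℤ_[p][G]} (hx : e * includeCoeff p G x = includeCoeff p G x)
    (h : ∀ z, IsNilpotent (reduceCoeff p G (x * z))) : reduceCoeff p G x = 0 := by
  have hsmul (y : ℤ_[p][G]) :
      includeCoeff p G ((p : ℤ_[p]) • y) = (p : ℚ_[p]) • includeCoeff p G y := by
    rw [Nat.cast_smul_eq_nsmul, Nat.cast_smul_eq_nsmul, map_nsmul]
  obtain ⟨w, hw, hxw⟩ := exists_eq_smul_of_forall_pow_eq_smul hχ hfull hx fun g => by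
    obtain ⟨k, hk⟩ := h (MonoidAlgebra.single g 1)
    rw [← map_pow] at hk
    obtain ⟨y, hy⟩ := reduceCoeff_eq_zero_iff.mp hk
    refine ⟨k, includeCoeff p G y, isIntegral_of_mem_integralGroupRing ⟨y, rfl⟩, ?_⟩
    rw [← hsmul, ← hy, map_pow, map_mul, MonoidAlgebra.mapRingHom_single, map_one]
  obtain ⟨w, rfl⟩ := exists_integral_lift hw
  exact reduceCoeff_eq_zero_iff.mpr ⟨w, includeCoeff_injective (by rw [hsmul, hxw])⟩

variable {m : ℕ} {D : Type*} [DivisionRing D] [Algebra ℚ_[p] D]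

/-- For a minimal idempotent f below e, self-duality removes nilpotents modulo p, so f ℤ_p[G] f is
commutative. Its ℚ_p-span is a nonzero corner E M_m(D) E, which is commutative only if D is. -/
theorem mul_comm_of_hasFullDegreeValuation (he : IsCentralPrimitiveIdempotent e)
    (φ : he.idem.Corner ≃ₐ[ℚ_[p]] Matrix (Fin m) (Fin m) D) (hint : e ∈ integralGroupRing p G)
    (hχ : χ ∈ characterClass p e) (hfull : HasFullDegreeValuation p χ) (c d : D) :
    c * d = d * c := by
  obtain ⟨e', rfl⟩ := exists_integral_lift hint
  have he' : e' * e' = e' := includeCoeff_injective (by rw [map_mul, he.idem.eq])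
  obtain ⟨f, hf, hef, hf0, hmin⟩ := exists_minimal_idempotent he'
    fun h => he.ne_zero (by rw [h, map_zero])
  obtain ⟨a, ha⟩ := exists_generator_of_minimal_idempotent hf hf0 hmin fun x hx hx' hnil =>
    reduceCoeff_eq_zero_of_forall_isNilpotent hχ hfull
      (by rw [← map_mul, ← hx, ← mul_assoc, hef])
      fun z => isNilpotent_reduceCoeff_mul hf hf0 hmin hx hx' hnil z
  set F := includeCoeff p G f with hFdef
  have hFF : F * F = F := by rw [← map_mul, hf]
  have hcomm (z z' : ℚ_[p][G]) : (F * z * F) * (F * z' * F) = (F * z' * F) * (F * z * F) := by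
    induction z using MonoidAlgebra.induction_linear with
    | zero => simp
    | add x y hx hy => simp only [mul_add, add_mul] at hx hy ⊢; rw [hx, hy]
    | single g r =>
      induction z' using MonoidAlgebra.induction_linear with
      | zero => simp
      | add x y hx hy => simp only [mul_add, add_mul] at hx hy ⊢; rw [hx, hy]
      | single g' r' =>
        have hsplit (g : G) (r : ℚ_[p]) : F * MonoidAlgebra.single g r * F =
            r • includeCoeff p G (f * MonoidAlgebra.single g 1 * f) := by
          rw [map_mul, map_mul, MonoidAlgebra.mapRingHom_single, map_one, ← smul_mul_assoc,
            ← mul_smul_comm, MonoidAlgebra.smul_single, smul_eq_mul, mul_one]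
        have hcor (g : G) : f * (f * MonoidAlgebra.single g 1 * f) = f * MonoidAlgebra.single g 1 * f ∧
            f * MonoidAlgebra.single g 1 * f * f = f * MonoidAlgebra.single g 1 * f :=
          ⟨by simp only [← mul_assoc, hf], by rw [mul_assoc, hf]⟩
        rw [hsplit, hsplit, smul_mul_smul_comm, smul_mul_smul_comm, ← map_mul, ← map_mul,
          commute_of_generator ha (hcor g) (hcor g'), mul_comm r]
  have heF : includeCoeff p G e' * F = F := by rw [← map_mul, hef]
  let E : he.idem.Corner := cornerMk he.idem F ⟨heF, by rw [← he.central, heF]⟩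
  refine mul_comm_of_matrix_corner_comm (E := φ E) (fun h => hf0 ?_) ?_ (fun X Y => ?_) c d
  · apply includeCoeff_injective
    rw [map_zero]
    exact congrArg Subtype.val ((map_eq_zero_iff φ φ.injective).mp h)
  · rw [← map_mul]
    exact congrArg φ (Subtype.ext hFF)
  · obtain ⟨x, rfl⟩ := φ.surjective X
    obtain ⟨y, rfl⟩ := φ.surjective Y
    simp only [← map_mul]
    exact congrArg φ (Subtype.ext (hcomm x.1 y.1))

theorem isSchurIndex_one_of_mul_comm {K : Type*} [Field K] [Algebra K D]
    (h : ∀ c d : D, c * d = d * c) : IsSchurIndex K D 1 := by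
  rw [IsSchurIndex, one_pow]
  let L : Subalgebra.center K D ≃ₗ[Subalgebra.center K D] D :=
    LinearEquiv.ofBijective (LinearMap.toSpanSingleton (Subalgebra.center K D) D 1)
      ⟨fun x y hxy => Subtype.ext (by simpa [Subalgebra.smul_def] using hxy),
        fun d => ⟨⟨d, Subalgebra.mem_center_iff.mpr fun c => h c d⟩, by
          simp [Subalgebra.smul_def]⟩⟩
  rw [← L.finrank_eq, Module.finrank_self]

end SchurIndex

/-! ### The equivalences and the Schur index -/

theorem mainTheorem10 (p : ℕ) [Fact p.Prime] {G : Type*} [Group G] [Fintype G]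
    (e : ℚ_[p][G]) (he : IsCentralPrimitiveIdempotent e)
    (m : ℕ) {D : Type*} [DivisionRing D] [Algebra ℚ_[p] D]
    (_φ : he.idem.Corner ≃ₐ[ℚ_[p]] Matrix (Fin m) (Fin m) D) :
    List.TFAE
      [ e ∈ integralGroupRing p G,
        e ∈ integralGroupRing p G ∧
          IsMaximalOrder ℤ_[p] ℚ_[p] (integralGroupRingMul p he),
        e ∈ integralGroupRing p G ∧
          IsUnramifiedOverPadic p (Subalgebra.center ℚ_[p] D),
        ∃ χ ∈ characterClass p e, HasFullDegreeValuation p χ,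
        ∀ χ ∈ characterClass p e, HasFullDegreeValuation p χ ] ∧
    (e ∈ integralGroupRing p G → IsSchurIndex ℚ_[p] D 1) := by
  -- Without a member of the class, the condition on every χ would be vacuous and would not imply
  -- the one on some χ.
  obtain ⟨χ, hχ⟩ := nonempty_characterClass he
  have hfull (h : e ∈ integralGroupRing p G) : HasFullDegreeValuation p χ :=
    hasFullDegreeValuation_of_mem_integralGroupRing he _φ h hχ
  constructor
  · tfae_have 1 → 2 := fun h => ⟨h, isMaximalOrder_integralGroupRingMul he hχ (hfull h)⟩
    tfae_have 2 → 1 := And.left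
    tfae_have 1 → 3 := fun h => ⟨h, isUnramifiedOverPadic_center he _φ hχ (hfull h)⟩
    tfae_have 3 → 1 := And.left
    tfae_have 1 → 5 := fun h _ hψ => hasFullDegreeValuation_of_mem_integralGroupRing he _φ h hψ
    tfae_have 5 → 4 := fun h => ⟨χ, hχ, h χ hχ⟩
    tfae_have 4 → 1 := fun ⟨_, hψ, h⟩ => mem_integralGroupRing_of_hasFullDegreeValuation hψ h
    tfae_finish
  · exact fun h => isSchurIndex_one_of_mul_comm
      (mul_comm_of_hasFullDegreeValuation he _φ h hχ (hfull h))
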